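/- Let $n\ge 4$ and let $G$ be the complete geometric graph on the $n$ vertices, labelled clockwise $0,1,\dots,n-1$, of a convex $n$-gon $C$ in the plane (edges are straight segments). A \emph{diagonal} of $C$ is an edge of $G$ that is not a side of $C$. A \emph{triangulation} of $C$ is an inclusion-maximal set of pairwise non-crossing diagonals, where two distinct edges cross if they share an interior point. A \emph{blocker} is a set of edges of $G$ that has an edge in common with every triangulation of $C$ and has the smallest possible number of edges among all such sets. Two blockers are identified if one is obtained from the other by a cyclic rotation $i\mapsto i+r \pmod n$ of the vertex labels. Then the number of blockers, up to this identification, is $F_{2n-8}$, where $F_1=F_2=1$, $F_k=F_{k-1}+F_{k-2}$ for $k\ge 3$, and, by convention, $F_0=1$. -/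

import Mathlib

/-- The Euclidean plane. -/
abbrev Plane : Type := EuclideanSpace ℝ (Fin 2)

/-- Twice the signed area of the triangle `a b c`; it is negative exactly when `a, b, c` make a
clockwise turn. -/
def signedArea (a b c : Plane) : ℝ :=
  (b 0 - a 0) * (c 1 - a 1) - (b 1 - a 1) * (c 0 - a 0)

/-- The points `p 0, p 1, …, p (n - 1)` are in (strictly) convex position and are the vertices of
a convex polygon in clockwise order: every three of them, taken in the order of their labels,
make a clockwise turn. -/
def IsClockwiseConvexPolygon {n : ℕ} (p : Fin n → Plane) : Prop :=
  ∀ i j k : Fin n, i < j → j < k → signedArea (p i) (p j) (p k) < 0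

/-- The order `min {|i - j|, n - |i - j|}` of the edge `{i, j}`. Sides of the polygon have
order `1` (and a loop would have order `0`). -/
def edgeOrder {n : ℕ} (e : Sym2 (Fin n)) : ℕ :=
  Sym2.lift ⟨fun i j : Fin n =>
      min (((i : ℕ) : ℤ) - ((j : ℕ) : ℤ)).natAbs
        (n - (((i : ℕ) : ℤ) - ((j : ℕ) : ℤ)).natAbs),
    fun i j => by dsimp only; omega⟩ e

/-- A diagonal is an edge of order at least `2`. -/
def IsDiagonal {n : ℕ} (e : Sym2 (Fin n)) : Prop := 2 ≤ edgeOrder e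

/-- The relative interior of the straight segment that realizes an edge in the plane. -/
def edgeInterior {n : ℕ} (p : Fin n → Plane) (e : Sym2 (Fin n)) : Set Plane :=
  Sym2.lift ⟨fun i j : Fin n => openSegment ℝ (p i) (p j),
    fun i j => openSegment_symm ℝ (p i) (p j)⟩ e

/-- Two (distinct) edges cross if they share an interior point. -/
def Cross {n : ℕ} (p : Fin n → Plane) (e f : Sym2 (Fin n)) : Prop :=
  (edgeInterior p e ∩ edgeInterior p f).Nonempty

/-- A set of diagonals in which no two distinct members cross. -/
def IsNonCrossingDiagonals {n : ℕ} (p : Fin n → Plane) (T : Finset (Sym2 (Fin n))) : Prop :=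
  (∀ e ∈ T, IsDiagonal e) ∧ ∀ e ∈ T, ∀ f ∈ T, e ≠ f → ¬ Cross p e f

/-- A triangulation is an inclusion-maximal pairwise non-crossing set of diagonals. -/
def IsTriangulation {n : ℕ} (p : Fin n → Plane) (T : Finset (Sym2 (Fin n))) : Prop :=
  Maximal (IsNonCrossingDiagonals p) T

/-- A blocking set: a set of edges of the complete graph that shares an edge with every
triangulation. -/
def IsBlockingSet {n : ℕ} (p : Fin n → Plane) (B : Finset (Sym2 (Fin n))) : Prop :=
  (∀ e ∈ B, e ∈ (⊤ : SimpleGraph (Fin n)).edgeSet) ∧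
    ∀ T : Finset (Sym2 (Fin n)), IsTriangulation p T → ∃ e ∈ B, e ∈ T

/-- A blocker: a blocking set with the smallest possible number of edges. -/
def IsBlocker {n : ℕ} (p : Fin n → Plane) (B : Finset (Sym2 (Fin n))) : Prop :=
  IsBlockingSet p B ∧ ∀ B' : Finset (Sym2 (Fin n)), IsBlockingSet p B' → B.card ≤ B'.card

/-- `B'` arises from `B` by a cyclic rotation `i ↦ i + r (mod n)` of the labels. -/
def IsRotationOf {n : ℕ} (B B' : Finset (Sym2 (Fin n))) : Prop :=
  ∃ g ∈ Subgroup.zpowers (finRotate n), B.image (Sym2.map g) = B'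

/-- Equality of blockers up to rotation. -/
def rotationSetoid {n : ℕ} (p : Fin n → Plane) :
    Setoid {B : Finset (Sym2 (Fin n)) // IsBlocker p B} where
  r B B' := IsRotationOf B.1 B'.1
  iseqv :=
    { refl := fun B => ⟨1, one_mem _, by simp [Equiv.Perm.coe_one, Sym2.map_id]⟩
      symm := by
        rintro B B' ⟨g, hg, h⟩
        refine ⟨g⁻¹, inv_mem hg, ?_⟩
        rw [← h, Finset.image_image, ← Sym2.map_comp, ← Equiv.Perm.coe_mul, inv_mul_cancel]
        simp [Equiv.Perm.coe_one, Sym2.map_id]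
      trans := by
        rintro B B' B'' ⟨g, hg, h⟩ ⟨g', hg', h'⟩
        refine ⟨g' * g, mul_mem hg' hg, ?_⟩
        rw [← h', ← h, Finset.image_image, ← Sym2.map_comp, ← Equiv.Perm.coe_mul] }

/-- The number of blockers of the polygon `p`, counted up to rotation. -/
noncomputable def blockerCount {n : ℕ} (p : Fin n → Plane) : ℕ :=
  Nat.card (Quotient (rotationSetoid p))

/-- The Fibonacci sequence `F 1 = F 2 = 1`, `F k = F (k - 1) + F (k - 2)` for `k ≥ 3`, with the
convention `F 0 = 1`. -/
def fibF (k : ℕ) : ℕ := if k = 0 then 1 else Nat.fib k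

/-!
Write an edge set as a symmetric relation `E` on the labels `0, …, n - 1`. Only the order of the
labels matters: two edges of a convex polygon cross exactly if their ends interleave
(`IsClockwiseConvexPolygon.cross_iff`).

Every triangulation has an ear, a diagonal that cuts off a single vertex. Hence `E` is blocking if
and only if for each vertex `v` either the diagonal that cuts off `v` (called the ear at `v`) is in
`E`, or `E` blocks the polygon without `v` (`Blk`, `not_blk_iff`, `isBlockingSet_iff`). Since `E`
also meets the fan at `v`, cutting off a vertex whose ear is missing removes at least one edge, so
a blocking set has at least `n - 2` edges (`Blk.le_degSum`).

If there are exactly `n - 2` edges, a vertex with missing ear has degree one, and cutting it off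
leaves a smallest blocking set of the smaller polygon; its neighbour has an ear, since otherwise the
smaller polygon would have an unblocked fan. Two facts follow by induction on `n`. The vertices with
ears form a cyclic interval (`MinBlk.exists_ears_interval`), which a rotation moves to
`0, …, s - 1`. And two crossing edges always have ends that are neighbouring vertices with ears
(`MinBlk.crossAdj`). So, after the rotation, the vertices `2, …, s` are joined by the edges
`{j - 2, j}`, the last one is joined to `1`, and the vertices `s + 1, …, n - 2` are joined to
vertices less than `s` that form a word in which no letter exceeds an earlier one by more than `1`;
its first letter is not `s - 1` and its last letter is not `0`, as the ears at `s` and `n - 1` are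
missing (`MinBlk.exists_code`).

Conversely all these edge sets are blocking: they belong to a class of edge sets (`RootedBy`) that
is preserved when any vertex without ear is cut off, and that has no member on three vertices
(`RootedBy.blk`). For `n ≥ 5` the rotation is recovered from the set of ears, so different words
give blockers that are not rotations of each other (`eq_of_isRotationOf`). Finally the words are
counted by a recursion on the first letter: those with any last letter are counted by a Fibonacci
number of odd index (`card_sizedWords`), and appending a letter `0` is always possible, so those
with last letter different from `0` are counted by a difference of two such numbers (`card_codes`).
-/

/-! ### Crossing edges of a convex polygon -/

theorem signedArea_combination (a b c d : Plane) {t u : ℝ} (h : t + u = 1) :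
    signedArea a b (t • c + u • d) = t * signedArea a b c + u * signedArea a b d := by
  obtain rfl : t = 1 - u := by linarith
  simp only [signedArea, PiLp.add_apply, PiLp.smul_apply, smul_eq_mul]
  ring

theorem signedArea_swap (a b c : Plane) : signedArea a b c = -signedArea a c b := by
  simp only [signedArea]; ring

theorem signedArea_cycle (a b c : Plane) : signedArea a b c = signedArea c a b := by
  simp only [signedArea]; ring

theorem signedArea_left (a b : Plane) : signedArea a b a = 0 := by
  simp only [signedArea]; ring

theorem signedArea_right (a b : Plane) : signedArea a b b = 0 := by
  simp only [signedArea]; ring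

/-- If both ends of the segment `cd` lie in the same closed half plane of the line `ab`, not both
on the line, then the open segments `ab` and `cd` are disjoint. -/
theorem openSegment_disjoint_of_signedArea {a b c d : Plane}
    (h : (0 ≤ signedArea a b c ∧ 0 ≤ signedArea a b d) ∨
      (signedArea a b c ≤ 0 ∧ signedArea a b d ≤ 0))
    (h0 : ¬(signedArea a b c = 0 ∧ signedArea a b d = 0)) :
    ¬(openSegment ℝ a b ∩ openSegment ℝ c d).Nonempty := by
  rintro ⟨x, ⟨t, u, ht, hu, htu, rfl⟩, ⟨t', u', ht', hu', htu', hx⟩⟩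
  have h1 := signedArea_combination a b a b htu
  rw [← hx, signedArea_combination a b c d htu', signedArea_left, signedArea_right] at h1
  apply h0
  rcases h with ⟨hc, hd⟩ | ⟨hc, hd⟩
  · constructor <;> nlinarith [mul_nonneg ht'.le hc, mul_nonneg hu'.le hd]
  · constructor <;>
      nlinarith [mul_nonneg ht'.le (neg_nonneg.2 hc), mul_nonneg hu'.le (neg_nonneg.2 hd)]

/-- The diagonals of a quadrilateral intersect in the point that divides each of them in the
ratio of the areas on its two sides. -/
theorem openSegment_inter_nonempty_of_signedArea {a b c d : Plane}
    (hb : 0 < signedArea a c b) (hd : signedArea a c d < 0)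
    (ha : signedArea b d a < 0) (hc : 0 < signedArea b d c) :
    (openSegment ℝ a c ∩ openSegment ℝ b d).Nonempty := by
  set D := signedArea a c b - signedArea a c d with hD
  have hDpos : 0 < D := by linarith
  have hD' : D = signedArea b d c - signedArea b d a := by
    simp only [hD, signedArea]; ring
  refine ⟨(signedArea b d c / D) • a + (-signedArea b d a / D) • c,
    ⟨_, _, div_pos hc hDpos, div_pos (by linarith) hDpos, ?_, rfl⟩,
    ⟨-signedArea a c d / D, signedArea a c b / D, div_pos (by linarith) hDpos,
      div_pos hb hDpos, ?_, ?_⟩⟩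
  · rw [← add_div, div_eq_one_iff_eq hDpos.ne']; linarith
  · rw [← add_div, div_eq_one_iff_eq hDpos.ne']; linarith
  · ext k
    simp only [PiLp.add_apply, PiLp.smul_apply, smul_eq_mul]
    rw [div_mul_eq_mul_div, div_mul_eq_mul_div, div_mul_eq_mul_div, div_mul_eq_mul_div,
      ← add_div, ← add_div]
    congr 1
    fin_cases k <;> simp only [signedArea, Fin.zero_eta, Fin.mk_one] <;> ring

section
variable {n : ℕ} {p : Fin n → Plane}

theorem IsClockwiseConvexPolygon.signedArea_outside (hp : IsClockwiseConvexPolygon p)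
    {i j k : Fin n} (hij : i < j) (hk : k < i ∨ j < k) :
    signedArea (p i) (p j) (p k) < 0 := by
  rcases hk with hk | hk
  · rw [signedArea_cycle]; exact hp k i j hk hij
  · exact hp i j k hij hk

theorem IsClockwiseConvexPolygon.signedArea_inside (hp : IsClockwiseConvexPolygon p)
    {i j k : Fin n} (hik : i < k) (hkj : k < j) :
    0 < signedArea (p i) (p j) (p k) := by
  rw [signedArea_swap]; linarith [hp i k j hik hkj]

/-- In a convex polygon two edges cross exactly if their ends interleave. -/
theorem IsClockwiseConvexPolygon.cross_iff (hp : IsClockwiseConvexPolygon p)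
    {i j b d : Fin n} (hij : i < j) (hbd : b ≠ d) (hne : s(i, j) ≠ s(b, d)) :
    Cross p s(i, j) s(b, d) ↔
      (i < b ∧ b < j ∧ (d < i ∨ j < d)) ∨ (i < d ∧ d < j ∧ (b < i ∨ j < b)) := by
  have key : ∀ b d : Fin n, i < b → b < j → (d < i ∨ j < d) →
      (openSegment ℝ (p i) (p j) ∩ openSegment ℝ (p b) (p d)).Nonempty := by
    intro b d hib hbj hd
    rcases hd with hd | hd
    · rw [Set.inter_comm, openSegment_symm ℝ (p b), Set.inter_comm]
      rw [openSegment_symm ℝ (p i)]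
      apply openSegment_inter_nonempty_of_signedArea
      · have := hp.signedArea_outside hij (Or.inl hd)
        rw [signedArea_cycle, signedArea_swap]; rw [signedArea_swap] at this
        simp only [signedArea] at *; linarith
      · have := hp.signedArea_inside hib hbj
        simp only [signedArea] at *; linarith
      · exact hp.signedArea_outside (hd.trans hib) (Or.inr hbj)
      · exact hp.signedArea_inside hd hib
    · exact openSegment_inter_nonempty_of_signedArea (hp.signedArea_inside hib hbj)
        (hp.signedArea_outside hij (Or.inr hd)) (hp.signedArea_outside (hbj.trans hd) (Or.inl hib))
        (hp.signedArea_inside hbj hd)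
  constructor
  · intro h
    by_contra hcon
    refine openSegment_disjoint_of_signedArea ?_ ?_ h
    · have side : ∀ k, (i < k ∧ k < j ∧ 0 < signedArea (p i) (p j) (p k)) ∨
          ((k < i ∨ j < k) ∧ signedArea (p i) (p j) (p k) < 0) ∨
          ((k = i ∨ k = j) ∧ signedArea (p i) (p j) (p k) = 0) := by
        intro k
        rcases lt_trichotomy k i with h1 | h1 | h1
        · exact Or.inr (Or.inl ⟨Or.inl h1, hp.signedArea_outside hij (Or.inl h1)⟩)
        · subst h1; exact Or.inr (Or.inr ⟨Or.inl rfl, signedArea_left _ _⟩)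
        rcases lt_trichotomy k j with h2 | h2 | h2
        · exact Or.inl ⟨h1, h2, hp.signedArea_inside h1 h2⟩
        · subst h2; exact Or.inr (Or.inr ⟨Or.inr rfl, signedArea_right _ _⟩)
        · exact Or.inr (Or.inl ⟨Or.inr h2, hp.signedArea_outside hij (Or.inr h2)⟩)
      rcases side b with ⟨h1, h2, h3⟩ | ⟨h1, h3⟩ | ⟨h1, h3⟩ <;>
      rcases side d with ⟨h1', h2', h3'⟩ | ⟨h1', h3'⟩ | ⟨h1', h3'⟩
      · exact Or.inl ⟨h3.le, h3'.le⟩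
      · exact absurd (Or.inl ⟨h1, h2, h1'⟩) hcon
      · exact Or.inl ⟨h3.le, h3'.ge⟩
      · exact absurd (Or.inr ⟨h1', h2', h1⟩) hcon
      · exact Or.inr ⟨h3.le, h3'.le⟩
      · exact Or.inr ⟨h3.le, h3'.le⟩
      · exact Or.inl ⟨h3.ge, h3'.le⟩
      · exact Or.inr ⟨h3.le, h3'.le⟩
      · exact Or.inr ⟨h3.le, h3'.le⟩
    · have zero : ∀ k, signedArea (p i) (p j) (p k) = 0 → k = i ∨ k = j := by
        intro k hk
        by_contra hcon
        rw [not_or] at hcon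
        rcases lt_or_gt_of_ne hcon.1 with h1 | h1
        · exact (hp.signedArea_outside hij (Or.inl h1)).ne hk
        rcases lt_or_gt_of_ne hcon.2 with h2 | h2
        · exact (hp.signedArea_inside h1 h2).ne' hk
        · exact (hp.signedArea_outside hij (Or.inr h2)).ne hk
      rintro ⟨hb, hd⟩
      rcases zero b hb with rfl | rfl <;> rcases zero d hd with rfl | rfl
      · exact hbd rfl
      · exact hne rfl
      · exact hne Sym2.eq_swap
      · exact hbd rfl
  · rintro (⟨h1, h2, h3⟩ | ⟨h1, h2, h3⟩)
    · exact key b d h1 h2 h3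
    · rw [Sym2.eq_swap (a := b)]; exact key d b h1 h2 h3

end

/-! ### Ear removal -/

/-- The rotation by `r` of a relation on the labels `0, …, n - 1`, read modulo `n`: the new label
`i` stands for the old label `i + r`. -/
def rot (n r : ℕ) (E : ℕ → ℕ → Prop) : ℕ → ℕ → Prop :=
  fun i j => E ((i + r) % n) ((j + r) % n)

theorem rot_rot (n r s : ℕ) (E : ℕ → ℕ → Prop) :
    rot n r (rot n s E) = rot n (r + s) E := by
  funext i j
  simp only [rot, Nat.mod_add_mod, add_assoc]

theorem rot_of_dvd {n r : ℕ} (h : n ∣ r) (E : ℕ → ℕ → Prop) {i j : ℕ} (hi : i < n) (hj : j < n) :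
    rot n r E i j ↔ E i j := by
  obtain ⟨k, rfl⟩ := h
  simp only [rot, Nat.add_mul_mod_self_left, Nat.mod_eq_of_lt hi, Nat.mod_eq_of_lt hj]

theorem rot_symm {n r : ℕ} {E : ℕ → ℕ → Prop} (h : ∀ i j, E i j → E j i) :
    ∀ i j, rot n r E i j → rot n r E j i := fun _ _ hij => h _ _ hij

theorem add_one_mod_cases {n i : ℕ} (hi : i < n) :
    (i + 1 < n ∧ (i + 1) % n = i + 1) ∨ (i + 1 = n ∧ (i + 1) % n = 0) := by
  rcases Nat.lt_or_ge (i + 1) n with h | h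
  · exact Or.inl ⟨h, Nat.mod_eq_of_lt h⟩
  · obtain rfl : n = i + 1 := by omega
    exact Or.inr ⟨rfl, Nat.mod_self _⟩

/-- A property of relations that is stable under rotation by one step is stable under all
rotations. -/
theorem rot_induction {n : ℕ} {P : (ℕ → ℕ → Prop) → Prop} (h0 : ∀ E, P E → P (rot n 0 E))
    (h1 : ∀ E, P E → P (rot n 1 E)) {E : ℕ → ℕ → Prop} (h : P E) (r : ℕ) : P (rot n r E) := by
  induction r with
  | zero => exact h0 E h
  | succ r ih => rw [add_comm, ← rot_rot]; exact h1 _ ih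

/-- `Blk n E` says that the edge set `E` blocks the polygon `0, …, n - 1`, by recursion over ears:
no triangle is blocked, and a larger polygon is blocked if, whichever vertex is cut off (after a
rotation it is the last one), the diagonal that cuts it off belongs to `E` or the remaining polygon
is blocked. -/
def Blk : ℕ → (ℕ → ℕ → Prop) → Prop
  | 0, _ => False
  | n + 1, E => 3 ≤ n ∧ ∀ r, rot (n + 1) r E 0 (n - 1) ∨ Blk n (rot (n + 1) r E)

theorem Blk.congr : ∀ {n : ℕ} {E E' : ℕ → ℕ → Prop},
    (∀ i j, i < n → j < n → (E i j ↔ E' i j)) → Blk n E → Blk n E'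
  | 0, _, _, _, h => h
  | n + 1, E, E', hE, h => by
    have key : ∀ r i j, rot (n + 1) r E i j ↔ rot (n + 1) r E' i j := fun r i j =>
      hE _ _ (Nat.mod_lt _ n.succ_pos) (Nat.mod_lt _ n.succ_pos)
    refine ⟨h.1, fun r => ?_⟩
    rcases h.2 r with h' | h'
    · exact Or.inl ((key _ _ _).1 h')
    · exact Or.inr (h'.congr fun i j _ _ => key r i j)

theorem Blk.rot {n : ℕ} {E : ℕ → ℕ → Prop} (h : Blk n E) (s : ℕ) : Blk n (rot n s E) := by
  cases n with
  | zero => exact h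
  | succ n =>
    refine ⟨h.1, fun r => ?_⟩
    rw [rot_rot]
    exact h.2 _

theorem Blk.four_le {n : ℕ} {E : ℕ → ℕ → Prop} (h : Blk n E) : 4 ≤ n := by
  cases n with
  | zero => exact h.elim
  | succ n => have := h.1; omega

/-! ### Combinatorial triangulations -/

/-- A maximal set of pairwise non-crossing pairs of labels in `0, …, n - 1`, as a symmetric
relation. Sides cross nothing, so they all belong to it. -/
structure IsTri (n : ℕ) (T : ℕ → ℕ → Prop) : Prop where
  symm : ∀ i j, T i j → T j i
  noncross : ∀ i j b d, i < b → b < j → j < n → d < n → T i j → T b d → i ≤ d ∧ d ≤ j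
  maximal : ∀ i j, i < j → j < n →
    (∀ b d, d < n → i < b → b < j → T b d → i ≤ d ∧ d ≤ j) → T i j

/-- No diagonal of the polygon `0, …, n - 1` lies in both relations. -/
def Avoids (n : ℕ) (T E : ℕ → ℕ → Prop) : Prop :=
  ∀ i j, i + 2 ≤ j → j < n → (0 < i ∨ j + 1 < n) → T i j → ¬E i j

theorem IsTri.congr {n : ℕ} {T T' : ℕ → ℕ → Prop} (hs : ∀ i j, T' i j → T' j i)
    (hT : ∀ i j, i < n → j < n → (T i j ↔ T' i j)) (h : IsTri n T) : IsTri n T' where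
  symm := hs
  noncross i j b d h1 h2 h3 h4 h5 h6 := h.noncross i j b d h1 h2 h3 h4
    ((hT _ _ (by omega) (by omega)).2 h5) ((hT _ _ (by omega) (by omega)).2 h6)
  maximal i j h1 h2 h3 := (hT _ _ (by omega) (by omega)).1 <| h.maximal i j h1 h2
    fun b d h4 h5 h6 h7 => h3 b d h4 h5 h6 ((hT _ _ (by omega) (by omega)).1 h7)

theorem IsTri.rot_zero {n : ℕ} {T : ℕ → ℕ → Prop} (h : IsTri n T) : IsTri n (rot n 0 T) :=
  h.congr (rot_symm h.symm) fun _ _ hi hj => (rot_of_dvd (dvd_zero n) T hi hj).symm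

theorem IsTri.rot_one {n : ℕ} {T : ℕ → ℕ → Prop} (h : IsTri n T) : IsTri n (rot n 1 T) where
  symm := rot_symm h.symm
  noncross i j b d hib hbj hjn hdn hij hbd := by
    simp only [rot] at hij hbd
    rw [(add_one_mod_cases (n := n) (i := i) (by omega)).resolve_right (by omega) |>.2] at hij
    rw [(add_one_mod_cases (n := n) (i := b) (by omega)).resolve_right (by omega) |>.2] at hbd
    rcases add_one_mod_cases (n := n) (i := j) (by omega) with ⟨hj, e⟩ | ⟨hj, e⟩ <;> rw [e] at hij
    · rcases add_one_mod_cases (n := n) (i := d) (by omega) with ⟨hd, e⟩ | ⟨hd, e⟩ <;> rw [e] at hbd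
      · have := h.noncross _ _ _ _ (by omega) (by omega) hj hd hij hbd; omega
      · have := h.noncross _ _ _ _ (by omega) (by omega) hj (by omega) hij hbd; omega
    · by_contra hcon
      have hd : d < i := by omega
      rw [(add_one_mod_cases (n := n) (i := d) (by omega)).resolve_right (by omega) |>.2] at hbd
      have := h.noncross 0 (i + 1) (d + 1) (b + 1) (by omega) (by omega) (by omega) (by omega)
        (h.symm _ _ hij) (h.symm _ _ hbd)
      omega
  maximal i j hij hjn H := by
    simp only [rot] at H ⊢
    rw [(add_one_mod_cases (n := n) (i := i) (by omega)).resolve_right (by omega) |>.2]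
    have lift : ∀ b d, 0 < b → b < n → d < n → T b d → ∃ b' d', b = b' + 1 ∧ d' < n ∧
        (d = d' + 1 ∨ d = 0 ∧ d' + 1 = n) ∧ T ((b' + 1) % n) ((d' + 1) % n) := by
      intro b d hb hbn hdn hbd
      obtain ⟨b, rfl⟩ : ∃ b', b = b' + 1 := ⟨b - 1, by omega⟩
      rcases Nat.eq_zero_or_pos d with rfl | hd
      · refine ⟨b, n - 1, rfl, by omega, Or.inr ⟨rfl, by omega⟩, ?_⟩
        rw [Nat.mod_eq_of_lt hbn, Nat.sub_add_cancel (by omega), Nat.mod_self]; exact hbd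
      · refine ⟨b, d - 1, rfl, by omega, Or.inl (by omega), ?_⟩
        rw [Nat.mod_eq_of_lt hbn, Nat.sub_add_cancel (by omega), Nat.mod_eq_of_lt hdn]; exact hbd
    rcases add_one_mod_cases (n := n) (i := j) (by omega) with ⟨hj, e⟩ | ⟨hj, e⟩ <;> rw [e]
    · refine h.maximal _ _ (by omega) hj fun b d hd hib hbj hbd => ?_
      obtain ⟨b', d', rfl, hd', hdd, hT⟩ := lift b d (by omega) (by omega) hd hbd
      have := H b' d' hd' (by omega) (by omega) hT
      omega
    · refine h.symm _ _ (h.maximal 0 _ (by omega) (by omega) fun b d hd hib hbj hbd => ?_)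
      obtain ⟨b', d', rfl, hd', hdd, hT⟩ := lift b d (by omega) (by omega) hd hbd
      by_contra hcon
      have := H d' b' (by omega) (by omega) (by omega) (h.symm _ _ hT)
      omega

theorem IsTri.rot {n : ℕ} {T : ℕ → ℕ → Prop} (h : IsTri n T) (r : ℕ) : IsTri n (rot n r T) :=
  rot_induction (fun _ h => h.rot_zero) (fun _ h => h.rot_one) h r

theorem Avoids.rot_zero {n : ℕ} {T E : ℕ → ℕ → Prop} (h : Avoids n T E) :
    Avoids n (rot n 0 T) (rot n 0 E) := by
  intro i j hij hj hd
  rw [rot_of_dvd (dvd_zero n) T (by omega) hj, rot_of_dvd (dvd_zero n) E (by omega) hj]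
  exact h i j hij hj hd

theorem Avoids.rot_one {n : ℕ} {T E : ℕ → ℕ → Prop} (hT : ∀ i j, T i j → T j i)
    (hE : ∀ i j, E i j → E j i) (h : Avoids n T E) : Avoids n (rot n 1 T) (rot n 1 E) := by
  intro i j hij hj hd hTij hEij
  simp only [rot] at hTij hEij
  rw [(add_one_mod_cases (n := n) (i := i) (by omega)).resolve_right (by omega) |>.2] at hTij hEij
  rcases add_one_mod_cases (n := n) (i := j) (by omega) with ⟨hj, e⟩ | ⟨hj, e⟩ <;>
    rw [e] at hTij hEij
  · exact h _ _ (by omega) hj (by omega) hTij hEij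
  · exact h 0 (i + 1) (by omega) (by omega) (by omega) (hT _ _ hTij) (hE _ _ hEij)

theorem Avoids.rot {n : ℕ} {T E : ℕ → ℕ → Prop} (hT : ∀ i j, T i j → T j i)
    (hE : ∀ i j, E i j → E j i) (h : Avoids n T E) (r : ℕ) :
    Avoids n (rot n r T) (rot n r E) := by
  induction r with
  | zero => exact h.rot_zero
  | succ r ih =>
    rw [add_comm, ← rot_rot, ← rot_rot n 1 r E]
    exact ih.rot_one (rot_symm hT) (rot_symm hE)

/-- Every triangulation of a polygon with at least four vertices has an ear: a shortest diagonal
`{i, i + 2}`. -/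
theorem IsTri.exists_ear {n : ℕ} {T : ℕ → ℕ → Prop} (h : IsTri n T) (hn : 3 ≤ n) :
    ∃ i, i + 2 < n ∧ T i (i + 2) := by
  classical
  have ex : ∃ d, 2 ≤ d ∧ ∃ i, i + d < n ∧ T i (i + d) := by
    refine ⟨n - 1, by omega, 0, by omega, h.maximal _ _ (by omega) (by omega) ?_⟩
    intro b d hd _ _ _; omega
  obtain ⟨h2, i, hi, hT⟩ := Nat.find_spec ex
  set d := Nat.find ex with hd
  rcases Nat.lt_or_ge 2 d with h3 | h3
  · -- otherwise the next shorter pair `{i, i + d - 1}` could be added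
    exfalso
    refine Nat.find_min ex (m := d - 1) (by omega) ⟨by omega, i, by omega, ?_⟩
    refine h.maximal _ _ (by omega) (by omega) fun b e he hib hbj hbe => ?_
    have h4 := h.noncross _ _ b e hib (by omega) hi he hT hbe
    refine ⟨h4.1, ?_⟩
    by_contra h5
    obtain rfl : e = i + d := by omega
    refine Nat.find_min ex (m := i + d - b) (by omega) ⟨by omega, b, by omega, ?_⟩
    rwa [show b + (i + d - b) = i + d by omega]
  · exact ⟨i, by omega, by rwa [show d = 2 by omega] at hT⟩

theorem IsTri.zero_last {n : ℕ} {T : ℕ → ℕ → Prop} (h : IsTri n T) (hn : 2 ≤ n) :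
    T 0 (n - 1) :=
  h.maximal _ _ (by omega) (by omega) fun _ _ _ _ _ _ => by omega

theorem IsTri.restrict {n : ℕ} {T : ℕ → ℕ → Prop} (h : IsTri (n + 1) T)
    (hear : T 0 (n - 1)) : IsTri n T where
  symm := h.symm
  noncross i j b d h1 h2 h3 h4 := h.noncross i j b d h1 h2 (by omega) (by omega)
  maximal i j hij hj H := h.maximal i j hij (by omega) fun b d hd hib hbj hbd => by
    rcases Nat.lt_or_ge d n with h1 | h1
    · exact H b d h1 hib hbj hbd
    · have := h.noncross 0 (n - 1) b d (by omega) (by omega) (by omega) hd hear hbd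
      omega

/-- Gluing a triangle with the new vertex `n` onto the side `{0, n - 1}`. -/
theorem IsTri.extend {n : ℕ} {T : ℕ → ℕ → Prop} (hn : 3 ≤ n) (h : IsTri n T) :
    IsTri (n + 1) fun i j => (i < n ∧ j < n ∧ T i j) ∨ (i = n ∧ (j = 0 ∨ j = n - 1)) ∨
      (j = n ∧ (i = 0 ∨ i = n - 1)) where
  symm i j hij := by
    rcases hij with ⟨h1, h2, h3⟩ | h1 | h1
    · exact Or.inl ⟨h2, h1, h.symm _ _ h3⟩
    · exact Or.inr (Or.inr h1)
    · exact Or.inr (Or.inl h1)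
  noncross i j b d hib hbj hj hd hij hbd := by
    rcases hij with ⟨h1, h2, h3⟩ | h1 | h1
    · rcases hbd with ⟨h4, h5, h6⟩ | h4 | h4
      · exact h.noncross i j b d hib hbj h2 h5 h3 h6
      · omega
      · omega
    · omega
    · rcases hbd with ⟨h4, h5, h6⟩ | h4 | h4 <;> omega
  maximal i j hij hj H := by
    rcases Nat.lt_or_ge j n with h1 | h1
    · refine Or.inl ⟨by omega, h1, h.maximal i j hij h1 fun b d hd hib hbj hbd => ?_⟩
      exact H b d (by omega) hib hbj (Or.inl ⟨by omega, hd, hbd⟩)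
    · refine Or.inr (Or.inr ⟨by omega, ?_⟩)
      by_contra hcon
      have := H (n - 1) 0 (by omega) (by omega) (by omega)
        (Or.inl ⟨by omega, by omega, h.symm _ _ (h.zero_last (by omega))⟩)
      omega

/-- The recursion over ears decides whether an edge set meets every triangulation. -/
theorem not_blk_iff {n : ℕ} (hn : 3 ≤ n) : ∀ {E : ℕ → ℕ → Prop}, (∀ i j, E i j → E j i) →
    (¬Blk n E ↔ ∃ T, IsTri n T ∧ Avoids n T E) := by
  induction n, hn using Nat.le_induction with
  | base =>
    intro E _
    refine ⟨fun _ => ⟨fun _ _ => True, ⟨fun _ _ _ => trivial, ?_, fun _ _ _ _ _ => trivial⟩, ?_⟩,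
      fun _ h => absurd h.four_le (by omega)⟩
    · intros; omega
    · intro i j h1 h2 h3; omega
  | succ n hn ih =>
    intro E hE
    constructor
    · intro h
      simp only [Blk, not_and, not_forall, not_or] at h
      obtain ⟨r, hr, hB⟩ := h hn
      obtain ⟨T, hT, hA⟩ := (ih (rot_symm hE)).1 hB
      have hA' : Avoids (n + 1) (fun i j => (i < n ∧ j < n ∧ T i j) ∨
          (i = n ∧ (j = 0 ∨ j = n - 1)) ∨ (j = n ∧ (i = 0 ∨ i = n - 1))) (rot (n + 1) r E) := by
        intro i j hij hj hd hTij
        rcases hTij with ⟨h1, h2, h3⟩ | h1 | h1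
        · by_cases h4 : 0 < i ∨ j + 1 < n
          · exact hA i j hij h2 h4 h3
          · obtain rfl : i = 0 := by omega
            obtain rfl : j = n - 1 := by omega
            exact hr
        · omega
        · omega
      have hT' := hT.extend hn
      refine ⟨_, hT'.rot ((n + 1) * r - r), ?_⟩
      have h1 := hA'.rot hT'.symm (rot_symm hE) ((n + 1) * r - r)
      rw [rot_rot, Nat.sub_add_cancel (Nat.le_mul_of_pos_left _ (by omega))] at h1
      intro i j hij hj hd hTij hEij
      exact h1 i j hij hj hd hTij ((rot_of_dvd (Dvd.intro _ rfl) E (by omega) hj).2 hEij)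
    · rintro ⟨T, hT, hA⟩ hB
      obtain ⟨i, hi, hTi⟩ := hT.exists_ear (by omega)
      have e1 : (0 + (i + 2)) % (n + 1) = i + 2 := by
        rw [Nat.zero_add]; exact Nat.mod_eq_of_lt hi
      have e2 : (n - 1 + (i + 2)) % (n + 1) = i := by
        rw [show n - 1 + (i + 2) = i + (n + 1) by omega, Nat.add_mod_right]
        exact Nat.mod_eq_of_lt (by omega)
      have hear : rot (n + 1) (i + 2) T 0 (n - 1) := by
        simp only [rot, e1, e2]; exact hT.symm _ _ hTi
      rcases hB.2 (i + 2) with h1 | h1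
      · simp only [rot, e1, e2] at h1
        exact hA i (i + 2) le_rfl hi (by omega) hTi (hE _ _ h1)
      · refine (ih (rot_symm hE)).2 ⟨_, (hT.rot (i + 2)).restrict hear, ?_⟩ h1
        intro a b hab hb _ hTab
        exact hA.rot hT.symm hE (i + 2) a b hab (by omega) (by omega) hTab

/-! ### Counting edges -/

theorem mod_cases {n x : ℕ} (hx : x < 2 * n) :
    (x < n ∧ x % n = x) ∨ (n ≤ x ∧ x % n = x - n) := by
  rcases Nat.lt_or_ge x n with h | h
  · exact Or.inl ⟨h, Nat.mod_eq_of_lt h⟩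
  · exact Or.inr ⟨h, by rw [Nat.mod_eq_sub_mod h, Nat.mod_eq_of_lt (by omega)]⟩

theorem add_mod_cancel {n i : ℕ} (r : ℕ) (hi : i < n) :
    ((i + r) % n + (n * r - r)) % n = i ∧ ((i + (n * r - r)) % n + r) % n = i := by
  have h : r ≤ n * r := Nat.le_mul_of_pos_left _ (by omega)
  constructor
  · rw [Nat.mod_add_mod, show i + r + (n * r - r) = i + n * r by omega, Nat.add_mul_mod_self_left,
      Nat.mod_eq_of_lt hi]
  · rw [Nat.mod_add_mod, show i + (n * r - r) + r = i + n * r by omega, Nat.add_mul_mod_self_left,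
      Nat.mod_eq_of_lt hi]

open Classical in
/-- The number of neighbours of the label `i` among `0, …, n - 1`. -/
noncomputable def deg (n : ℕ) (E : ℕ → ℕ → Prop) (i : ℕ) : ℕ :=
  ((Finset.range n).filter fun j => j ≠ i ∧ E i j).card

/-- The sum of the degrees, that is, twice the number of edges of a symmetric relation. -/
noncomputable def degSum (n : ℕ) (E : ℕ → ℕ → Prop) : ℕ :=
  ∑ i ∈ Finset.range n, deg n E i

theorem deg_rot {n r : ℕ} {E : ℕ → ℕ → Prop} {i : ℕ} (hi : i < n) :
    deg n (rot n r E) i = deg n E ((i + r) % n) := by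
  classical
  have hn : 0 < n := by omega
  refine Finset.card_nbij' (fun j => (j + r) % n) (fun j => (j + (n * r - r)) % n) ?_ ?_ ?_ ?_
  · intro j hj
    simp only [Finset.coe_filter, Finset.mem_range, Set.mem_ofPred_eq] at hj ⊢
    refine ⟨Nat.mod_lt _ hn, fun h => hj.2.1 ?_, hj.2.2⟩
    rw [← (add_mod_cancel r hj.1).1, h, (add_mod_cancel r hi).1]
  · intro j hj
    simp only [Finset.coe_filter, Finset.mem_range, Set.mem_ofPred_eq] at hj ⊢
    refine ⟨Nat.mod_lt _ hn, fun h => hj.2.1 ?_, ?_⟩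
    · rw [← h, (add_mod_cancel r hj.1).2]
    · simp only [rot, (add_mod_cancel r hj.1).2]; exact hj.2.2
  · intro j hj
    simp only [Finset.coe_filter, Finset.mem_range, Set.mem_ofPred_eq] at hj
    exact (add_mod_cancel r hj.1).1
  · intro j hj
    simp only [Finset.coe_filter, Finset.mem_range, Set.mem_ofPred_eq] at hj
    exact (add_mod_cancel r hj.1).2

theorem degSum_rot (n r : ℕ) (E : ℕ → ℕ → Prop) : degSum n (rot n r E) = degSum n E := by
  rcases Nat.eq_zero_or_pos n with rfl | hn
  · rfl
  refine Finset.sum_nbij' (fun j => (j + r) % n) (fun j => (j + (n * r - r)) % n) ?_ ?_ ?_ ?_ ?_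
  · intro j _; exact Finset.mem_range.2 (Nat.mod_lt _ hn)
  · intro j _; exact Finset.mem_range.2 (Nat.mod_lt _ hn)
  · intro j hj; exact (add_mod_cancel r (Finset.mem_range.1 hj)).1
  · intro j hj; exact (add_mod_cancel r (Finset.mem_range.1 hj)).2
  · intro j hj; exact deg_rot (Finset.mem_range.1 hj)

theorem degSum_succ {n : ℕ} {E : ℕ → ℕ → Prop} (hE : ∀ i j, E i j → E j i) :
    degSum (n + 1) E = degSum n E + 2 * deg (n + 1) E n := by
  classical
  have h1 : ∀ i ∈ Finset.range n, deg (n + 1) E i = deg n E i + if E n i then 1 else 0 := by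
    intro i hi
    have hi := Finset.mem_range.1 hi
    unfold deg
    rw [Finset.range_add_one, Finset.filter_insert]
    by_cases h : E n i
    · rw [if_pos ⟨by omega, hE _ _ h⟩, if_pos h, Finset.card_insert_of_notMem (by simp)]
    · rw [if_neg fun h' => h (hE _ _ h'.2), if_neg h, add_zero]
  have h2 : deg (n + 1) E n = ∑ i ∈ Finset.range n, if E n i then 1 else 0 := by
    rw [← Finset.card_filter]
    unfold deg
    congr 1
    ext i
    simp only [Finset.mem_filter, Finset.mem_range]
    constructor
    · rintro ⟨a, b, c⟩; exact ⟨by omega, c⟩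
    · rintro ⟨a, c⟩; exact ⟨by omega, by omega, c⟩
  unfold degSum
  rw [Finset.sum_range_succ, Finset.sum_congr rfl h1, Finset.sum_add_distrib, ← h2]
  ring

theorem deg_pos {n : ℕ} {E : ℕ → ℕ → Prop} {i j : ℕ} (hj : j < n) (hij : j ≠ i) (h : E i j) :
    1 ≤ deg n E i := by
  classical
  exact Finset.card_pos.2 ⟨j, by simp [hj, hij, h]⟩

theorem two_le_deg {n : ℕ} {E : ℕ → ℕ → Prop} {i j k : ℕ} (hj : j < n) (hij : j ≠ i) (h : E i j)
    (hk : k < n) (hik : k ≠ i) (h' : E i k) (hjk : j ≠ k) : 2 ≤ deg n E i := by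
  classical
  exact Finset.one_lt_card.2 ⟨j, by simp [hj, hij, h], k, by simp [hk, hik, h'], hjk⟩

/-! ### Ears -/

/-- The diagonal that cuts off the vertex `i` of the polygon `0, …, n - 1` belongs to `E`. -/
def ear (n : ℕ) (E : ℕ → ℕ → Prop) (i : ℕ) : Prop := E ((i + (n - 1)) % n) ((i + 1) % n)

theorem ear_rot (n r : ℕ) (E : ℕ → ℕ → Prop) (i : ℕ) :
    ear n (rot n r E) i ↔ ear n E ((i + r) % n) := by
  simp only [ear, rot, Nat.mod_add_mod]
  rw [show i + (n - 1) + r = i + r + (n - 1) by omega, show i + 1 + r = i + r + 1 by omega]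

theorem ear_mid {n i : ℕ} {E : ℕ → ℕ → Prop} (h1 : 1 ≤ i) (h2 : i + 1 < n) :
    ear n E i ↔ E (i - 1) (i + 1) := by
  rw [ear, show i + (n - 1) = i - 1 + n by omega, Nat.add_mod_right, Nat.mod_eq_of_lt h2,
    Nat.mod_eq_of_lt (by omega)]

theorem ear_zero {n : ℕ} {E : ℕ → ℕ → Prop} (h : 2 ≤ n) : ear n E 0 ↔ E (n - 1) 1 := by
  rw [ear, Nat.zero_add, Nat.zero_add, Nat.mod_eq_of_lt (by omega), Nat.mod_eq_of_lt (by omega)]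

theorem ear_last {n i : ℕ} {E : ℕ → ℕ → Prop} (h : 2 ≤ n) (hi : i + 1 = n) :
    ear n E i ↔ E (i - 1) 0 := by
  rw [ear, hi, Nat.mod_self, show i + (n - 1) = i - 1 + n by omega, Nat.add_mod_right,
    Nat.mod_eq_of_lt (by omega)]

theorem ear_congr {n i : ℕ} {E E' : ℕ → ℕ → Prop} (hn : 0 < n)
    (hE : ∀ i j, i < n → j < n → (E i j ↔ E' i j)) : ear n E i ↔ ear n E' i :=
  hE _ _ (Nat.mod_lt _ hn) (Nat.mod_lt _ hn)

/-- In a polygon with at least five vertices the two edges `{i - 2, i}` and `{i, i + 2}` are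
distinct. -/
theorem two_le_deg_of_ears {n : ℕ} {E : ℕ → ℕ → Prop} (hE : ∀ i j, E i j → E j i) (hn : 5 ≤ n)
    (h : ∀ i, i < n → ear n E i) {i : ℕ} (hi : i < n) : 2 ≤ deg n E i := by
  have h1 := h ((i + 1) % n) (Nat.mod_lt _ (by omega))
  have h2 := h ((i + (n - 1)) % n) (Nat.mod_lt _ (by omega))
  simp only [ear, Nat.mod_add_mod] at h1 h2
  rw [show i + 1 + (n - 1) = i + n by omega, Nat.add_mod_right, Nat.mod_eq_of_lt hi] at h1
  rw [show i + (n - 1) + 1 = i + n by omega, Nat.add_mod_right, Nat.mod_eq_of_lt hi,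
    show i + (n - 1) + (n - 1) = i + (n - 2) + n by omega, Nat.add_mod_right] at h2
  have h3 := mod_cases (n := n) (x := i + 1 + 1) (by omega)
  have h4 := mod_cases (n := n) (x := i + (n - 2)) (by omega)
  exact two_le_deg (Nat.mod_lt _ (by omega)) (by omega) h1 (Nat.mod_lt _ (by omega)) (by omega)
    (hE _ _ h2) (by omega)

/-- A blocked polygon is blocked at each fan. -/
theorem Blk.exists_fan_zero : ∀ {n : ℕ} {E : ℕ → ℕ → Prop}, Blk n E →
    ∃ i, 2 ≤ i ∧ i + 2 ≤ n ∧ E 0 i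
  | 0, _, h => h.elim
  | n + 1, E, h => by
    have h3 := h.1
    rcases h.2 0 with h1 | h1
    · exact ⟨n - 1, by have := h.1; omega, by omega,
        (rot_of_dvd (dvd_zero _) E (by omega) (by omega)).1 h1⟩
    · obtain ⟨i, hi, hin, hE⟩ := Blk.exists_fan_zero h1
      exact ⟨i, hi, by omega, (rot_of_dvd (dvd_zero _) E (by omega) (by omega)).1 hE⟩

theorem Blk.exists_fan {n : ℕ} {E : ℕ → ℕ → Prop} (h : Blk n E) {v : ℕ} (hv : v < n) :
    ∃ w, w < n ∧ w ≠ v ∧ (v + 1) % n ≠ w ∧ (w + 1) % n ≠ v ∧ E v w := by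
  obtain ⟨i, hi, hin, hE⟩ := (h.rot v).exists_fan_zero
  simp only [_root_.rot, Nat.zero_add, Nat.mod_eq_of_lt hv] at hE
  refine ⟨(i + v) % n, Nat.mod_lt _ (by omega), ?_, ?_, ?_, hE⟩
  · have := mod_cases (n := n) (x := i + v) (by omega); omega
  · have := mod_cases (n := n) (x := i + v) (by omega)
    have := mod_cases (n := n) (x := v + 1) (by omega); omega
  · rw [Nat.mod_add_mod]
    have := mod_cases (n := n) (x := i + v + 1) (by omega); omega

theorem ear_of_rot_last {n v : ℕ} {E : ℕ → ℕ → Prop} (hv : v < n) :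
    ear n (rot n (v + 1) E) (n - 1) ↔ ear n E v := by
  rw [ear_rot, show n - 1 + (v + 1) = v + n by omega, Nat.add_mod_right, Nat.mod_eq_of_lt hv]

theorem Blk.restrict {n : ℕ} {E : ℕ → ℕ → Prop} (hE : ∀ i j, E i j → E j i) (h : Blk (n + 1) E)
    (hear : ¬ear (n + 1) E n) : Blk n E := by
  have hn := h.1
  rw [ear_last (by omega) rfl] at hear
  rcases h.2 0 with h1 | h1
  · exact absurd (hE _ _ ((rot_of_dvd (dvd_zero _) E (by omega) (by omega)).1 h1)) hear
  · exact h1.congr fun i j hi hj => rot_of_dvd (dvd_zero _) E (by omega) (by omega)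

/-- A blocking set has at least `n - 2` edges: cut off a vertex whose ear is missing; since its
fan is blocked, this removes an edge. -/
theorem Blk.le_degSum {n : ℕ} (hn : 3 ≤ n) : ∀ {E : ℕ → ℕ → Prop}, (∀ i j, E i j → E j i) →
    Blk n E → 2 * (n - 2) ≤ degSum n E := by
  induction n, hn using Nat.le_induction with
  | base => intro E _ h; exact absurd h.four_le (by omega)
  | succ n hn ih =>
    intro E hE h
    by_cases hall : ∀ i, i < n + 1 → ear (n + 1) E i
    · have h1 : ∀ c, (∀ i, i < n + 1 → c ≤ deg (n + 1) E i) → (n + 1) * c ≤ degSum (n + 1) E := by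
        intro c hc
        have := Finset.card_nsmul_le_sum (Finset.range (n + 1)) (deg (n + 1) E) c
          fun i hi => hc i (Finset.mem_range.1 hi)
        simpa [degSum] using this
      rcases Nat.lt_or_ge n 4 with h4 | h4
      · have := h1 1 fun i hi => by
          obtain ⟨w, hw, hwi, -, -, hEw⟩ := h.exists_fan hi
          exact deg_pos hw hwi hEw
        omega
      · have := h1 2 fun i hi => two_le_deg_of_ears hE (by omega) hall hi
        omega
    · push Not at hall
      obtain ⟨v, hv, hear⟩ := hall
      rw [← ear_of_rot_last hv, Nat.add_sub_cancel] at hear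
      have hR := h.rot (v + 1)
      have h1 := ih (rot_symm hE) (hR.restrict (rot_symm hE) hear)
      obtain ⟨w, hw, hwn, -, -, hEw⟩ := hR.exists_fan n.lt_succ_self
      have h2 := deg_pos hw hwn hEw
      rw [← degSum_rot _ (v + 1), degSum_succ (rot_symm hE)]
      omega

/-! ### The structure of smallest blocking sets -/

/-- A blocking set with at most, hence exactly, `n - 2` edges. -/
structure MinBlk (n : ℕ) (E : ℕ → ℕ → Prop) : Prop where
  symm : ∀ i j, E i j → E j i
  blk : Blk n E
  degSum_le : degSum n E ≤ 2 * (n - 2)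

namespace MinBlk

variable {n : ℕ} {E : ℕ → ℕ → Prop}

theorem rot (h : MinBlk n E) (r : ℕ) : MinBlk n (rot n r E) :=
  ⟨rot_symm h.symm, h.blk.rot r, by rw [degSum_rot]; exact h.degSum_le⟩

theorem exists_not_ear (h : MinBlk n E) (hn : 5 ≤ n) : ∃ v, v < n ∧ ¬ear n E v := by
  by_contra hcon
  push Not at hcon
  have h1 : n * 2 ≤ degSum n E := by
    have := Finset.card_nsmul_le_sum (Finset.range n) (deg n E) 2
      fun i hi => two_le_deg_of_ears h.symm hn hcon (Finset.mem_range.1 hi)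
    simpa [degSum] using this
  have h2 := h.degSum_le
  omega

theorem restrict (h : MinBlk (n + 1) E) (hear : ¬ear (n + 1) E n) :
    MinBlk n E ∧ deg (n + 1) E n = 1 := by
  have hB := h.blk.restrict h.symm hear
  have h4 := hB.four_le
  obtain ⟨w, hw, hwn, -, -, hEw⟩ := h.blk.exists_fan n.lt_succ_self
  have h1 := deg_pos hw hwn hEw
  have h2 := h.degSum_le
  have h3 := hB.le_degSum (by omega) h.symm
  rw [degSum_succ h.symm] at h2
  exact ⟨⟨h.symm, hB, by omega⟩, by omega⟩

theorem deg_eq_one (h : MinBlk n E) {v : ℕ} (hv : v < n) (hear : ¬ear n E v) :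
    deg n E v = 1 := by
  rw [← ear_of_rot_last hv] at hear
  obtain ⟨n, rfl⟩ : ∃ m, n = m + 1 := ⟨n - 1, by omega⟩
  rw [Nat.add_sub_cancel] at hear
  have := ((h.rot (v + 1)).restrict hear).2
  rwa [deg_rot n.lt_succ_self, show n + (v + 1) = v + (n + 1) by omega, Nat.add_mod_right,
    Nat.mod_eq_of_lt hv] at this

/-- The neighbour of a vertex with missing ear is unique. -/
theorem unique_neighbor (h : MinBlk n E) {v x y : ℕ} (hv : v < n) (hear : ¬ear n E v)
    (hx : x < n) (hxv : x ≠ v) (hEx : E v x) (hy : y < n) (hyv : y ≠ v) (hEy : E v y) : x = y := by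
  by_contra hne
  have := two_le_deg hx hxv hEx hy hyv hEy hne
  have := h.deg_eq_one hv hear
  omega

/-- A vertex with missing ear is joined to a vertex whose ear is present: if both ears were
missing, then cutting off the one vertex would leave no edge at the other. -/
theorem exists_neighbor_last (h : MinBlk (n + 1) E) (hear : ¬ear (n + 1) E n) :
    ∃ w, 1 ≤ w ∧ w + 2 ≤ n ∧ E n w ∧ ear (n + 1) E w := by
  obtain ⟨w, hw, hwn, h1, h2, hEw⟩ := h.blk.exists_fan n.lt_succ_self
  rw [Nat.mod_self] at h1
  have hw2 : w + 2 ≤ n := by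
    rw [Nat.mod_eq_of_lt (by omega)] at h2; omega
  refine ⟨w, by omega, hw2, hEw, ?_⟩
  by_contra hcon
  obtain ⟨w', hw', hww', -, -, hEw'⟩ := (h.restrict hear).1.blk.exists_fan (v := w) (by omega)
  have := h.unique_neighbor hw hcon (x := n) (y := w') (by omega) (by omega) (h.symm _ _ hEw)
    (by omega) hww' hEw'
  omega

theorem exists_neighbor (h : MinBlk n E) {v : ℕ} (hv : v < n) (hear : ¬ear n E v) :
    ∃ w, w < n ∧ w ≠ v ∧ (v + 1) % n ≠ w ∧ (w + 1) % n ≠ v ∧ E v w ∧ ear n E w := by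
  rw [← ear_of_rot_last hv] at hear
  obtain ⟨n, rfl⟩ : ∃ m, n = m + 1 := ⟨n - 1, by omega⟩
  rw [Nat.add_sub_cancel] at hear
  obtain ⟨w, hw1, hw2, hEw, hw⟩ := (h.rot (v + 1)).exists_neighbor_last hear
  rw [ear_rot] at hw
  simp only [_root_.rot] at hEw
  rw [show n + (v + 1) = v + (n + 1) by omega, Nat.add_mod_right, Nat.mod_eq_of_lt hv] at hEw
  have h0 := mod_cases (n := n + 1) (x := w + (v + 1)) (by omega)
  refine ⟨_, Nat.mod_lt _ n.succ_pos, ?_, ?_, ?_, hEw, hw⟩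
  · omega
  · have := mod_cases (n := n + 1) (x := v + 1) (by omega); omega
  · rw [Nat.mod_add_mod]
    have := mod_cases (n := n + 1) (x := w + (v + 1) + 1) (by omega); omega

/-- If the present ears of the polygon without its last vertex form a cyclic interval, and the ear
at the last vertex is missing, then the present ears of the whole polygon form an interval. -/
theorem ears_interval_last (h : MinBlk (n + 1) E) (hn : 4 ≤ n) (hear : ¬ear (n + 1) E n)
    (ih : 5 ≤ n → ∃ r s, 2 ≤ s ∧ s + 2 ≤ n ∧ ∀ i, i < n → (ear n (_root_.rot n r E) i ↔ i < s)) :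
    ∃ a b, a < b ∧ b ≤ n ∧ ∀ i, i ≤ n → (ear (n + 1) E i ↔ a ≤ i ∧ i < b) := by
  obtain ⟨h', hdeg⟩ := h.restrict hear
  obtain ⟨w, hw1, hw2, hEw, hw⟩ := h.exists_neighbor_last hear
  have uniq : ∀ x, x < n → E n x → x = w := fun x hx hEx =>
    h.unique_neighbor n.lt_succ_self hear (by omega) (by omega) hEx (by omega) (by omega) hEw
  -- compared with the polygon without the vertex `n`, only the ears at `0` and `n - 1` change
  have e0 : ear (n + 1) E 0 ↔ w = 1 := by
    rw [ear_zero (by omega)]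
    exact ⟨fun h1 => (uniq 1 (by omega) h1).symm, fun h1 => by subst h1; exact hEw⟩
  have e1 : ear (n + 1) E (n - 1) ↔ w + 2 = n := by
    rw [ear_mid (by omega) (by omega), show n - 1 + 1 = n by omega]
    constructor
    · intro h1
      have := uniq (n - 1 - 1) (by omega) (h.symm _ _ h1); omega
    · intro h1
      rw [show n - 1 - 1 = w by omega]; exact h.symm _ _ hEw
  have e2 : ∀ i, 1 ≤ i → i + 2 ≤ n → (ear (n + 1) E i ↔ ear n E i) := fun i h1 h2 => by
    rw [ear_mid h1 (by omega), ear_mid h1 (by omega)]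
  have finish : ∀ a b, a < b → b ≤ n → (∀ i, 1 ≤ i → i + 2 ≤ n → (ear n E i ↔ a ≤ i ∧ i < b)) →
      (w = 1 ↔ a = 0) → (w + 2 = n ↔ b = n) →
      ∃ a b, a < b ∧ b ≤ n ∧ ∀ i, i ≤ n → (ear (n + 1) E i ↔ a ≤ i ∧ i < b) := by
    intro a b hab hb H ha hb'
    refine ⟨a, b, hab, hb, fun i hi => ?_⟩
    rcases Nat.eq_zero_or_pos i with rfl | hi0
    · rw [e0]; omega
    rcases Nat.lt_or_ge (i + 1) n with h1 | h1
    · rw [e2 i hi0 (by omega)]; exact H i hi0 (by omega)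
    rcases Nat.lt_or_ge i n with h2 | h2
    · obtain rfl : i = n - 1 := by omega
      rw [e1]; omega
    · obtain rfl : i = n := by omega
      exact ⟨fun h3 => absurd h3 hear, fun h3 => by omega⟩
  rw [e2 w hw1 hw2] at hw
  rcases Nat.eq_or_lt_of_le hn with h4 | h5
  · -- both diagonals of a quadrilateral belong to a blocking set
    subst h4
    have hall : ∀ i, i < 4 → ear 4 E i := fun i hi => by
      by_contra hcon
      rw [← ear_of_rot_last hi] at hcon
      exact absurd ((h'.blk.rot (i + 1)).restrict (rot_symm h.symm) hcon).four_le (by omega)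
    rcases (show w = 1 ∨ w = 2 by omega) with rfl | rfl
    · exact finish 0 3 (by omega) (by omega)
        (fun i _ _ => ⟨fun _ => by omega, fun _ => hall i (by omega)⟩) (by omega) (by omega)
    · exact finish 1 4 (by omega) (by omega)
        (fun i _ _ => ⟨fun _ => by omega, fun _ => hall i (by omega)⟩) (by omega) (by omega)
  obtain ⟨r, s, hs, hsn, H⟩ := ih h5
  have hr := Nat.mod_lt r (show 0 < n by omega)
  have H' : ∀ j, j < n → (ear n E j ↔ (r % n ≤ j ∧ j < r % n + s) ∨ j + n < r % n + s) := by
    intro j hj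
    have h1 := H ((j + (n - r % n)) % n) (Nat.mod_lt _ (by omega))
    have h2 : ((j + (n - r % n)) % n + r) % n = j := by
      rw [Nat.mod_add_mod, Nat.add_mod_eq_add_mod_left (j + (n - r % n)) (Nat.mod_mod r n).symm,
        show j + (n - r % n) + r % n = j + n by omega, Nat.add_mod_right, Nat.mod_eq_of_lt hj]
    rw [ear_rot, h2] at h1
    rw [h1]
    have := mod_cases (n := n) (x := j + (n - r % n)) (by omega)
    omega
  set q := r % n
  rw [H' w (by omega)] at hw
  rcases Nat.lt_or_ge n (q + s) with hc | hc
  · -- the interval of the smaller polygon wraps around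
    have d0 : ear n E 0 := (H' 0 (by omega)).2 (by omega)
    have d1 : ear n E (n - 1) := (H' (n - 1) (by omega)).2 (by omega)
    rw [ear_zero (by omega)] at d0
    rw [ear_last (by omega) (by omega)] at d1
    -- a neighbour of the last vertex with missing ear has degree one, so it ends the interval
    rcases Nat.lt_or_ge (w + 2) n with hwn | hwn
    · have hq : q + 1 = n := by
        by_contra hq
        have d2 : ear n E (n - 2) := (H' (n - 2) (by omega)).2 (by omega)
        rw [ear_mid (by omega) (by omega), show n - 2 + 1 = n - 1 by omega] at d2
        have := h.unique_neighbor (v := n - 1) (by omega) (by rw [e1]; omega) (x := 1)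
          (y := n - 2 - 1) (by omega) (by omega) d0 (by omega) (by omega) (h.symm _ _ d2)
        omega
      by_cases hw' : w = 1
      · exact finish 0 (q + s - n) (by omega) (by omega)
          (fun i _ _ => by rw [H' i (by omega)]; omega) (by omega) (by omega)
      · exact finish 1 (q + s - n) (by omega) (by omega)
          (fun i _ _ => by rw [H' i (by omega)]; omega) (by omega) (by omega)
    · have hq : q + s = n + 1 := by
        by_contra hq
        have d2 : ear n E 1 := (H' 1 (by omega)).2 (by omega)
        rw [ear_mid (by omega) (by omega)] at d2
        have := h.unique_neighbor (v := 0) (by omega) (by rw [e0]; omega) (x := n - 1 - 1)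
          (y := 2) (by omega) (by omega) (h.symm _ _ d1) (by omega) (by omega) d2
        omega
      exact finish q n (by omega) (by omega)
        (fun i _ _ => by rw [H' i (by omega)]; omega) (by omega) (by omega)
  · by_cases hw0 : w = 1
    · exact finish 0 (min (q + s) (n - 1)) (by omega) (by omega)
        (fun i _ _ => by rw [H' i (by omega)]; omega) (by omega) (by omega)
    by_cases hwn : w + 2 = n
    · exact finish (max q 1) n (by omega) (by omega)
        (fun i _ _ => by rw [H' i (by omega)]; omega) (by omega) (by omega)
    · exact finish (max q 1) (min (q + s) (n - 1)) (by omega) (by omega)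
        (fun i _ _ => by rw [H' i (by omega)]; omega) (by omega) (by omega)

/-- The vertices whose ear belongs to a smallest blocking set form a cyclic interval, which after
a rotation is `0, …, s - 1`; it and its complement have at least two elements. -/
theorem exists_ears_interval (hn : 5 ≤ n) (h : MinBlk n E) :
    ∃ r s, 2 ≤ s ∧ s + 2 ≤ n ∧ ∀ i, i < n → (ear n (_root_.rot n r E) i ↔ i < s) := by
  suffices H : ∀ m, 4 ≤ m → ∀ E, MinBlk m E → 5 ≤ m →
      ∃ r s, 2 ≤ s ∧ s + 2 ≤ m ∧ ∀ i, i < m → (ear m (_root_.rot m r E) i ↔ i < s) from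
    H n (by omega) E h hn
  intro m hm
  induction m, hm using Nat.le_induction with
  | base => intro E _ h; omega
  | succ n hn ih =>
    intro E h _
    obtain ⟨v, hv, hear⟩ := h.exists_not_ear (by omega)
    rw [← ear_of_rot_last hv, Nat.add_sub_cancel] at hear
    have h1 := h.rot (v + 1)
    set F := _root_.rot (n + 1) (v + 1) E with hF
    obtain ⟨a, b, hab, hb, H⟩ := h1.ears_interval_last hn hear (ih F (h1.restrict hear).1)
    have hab2 : a + 2 ≤ b := by
      -- a vertex next to a one-element interval would have no possible neighbour
      by_contra hcon
      obtain ⟨w, hw, -, -, hw2, -, hwear⟩ := h1.exists_neighbor (v := a + 1) (by omega)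
        (by rw [H _ (by omega)]; omega)
      rw [H _ (by omega)] at hwear
      rw [Nat.mod_eq_of_lt (by omega)] at hw2
      omega
    have hba : b - a + 1 ≤ n := by
      by_contra hcon
      have h0 := (H 0 (by omega)).2 (by omega)
      have h2 := (H (n - 1) (by omega)).2 (by omega)
      rw [ear_zero (by omega)] at h0
      rw [ear_mid (by omega) (by omega), show n - 1 + 1 = n by omega] at h2
      have := h1.unique_neighbor n.lt_succ_self hear (x := 1) (y := n - 1 - 1) (by omega)
        (by omega) h0 (by omega) (by omega) (h1.symm _ _ h2)
      omega
    refine ⟨a + (v + 1), b - a, by omega, by omega, fun i hi => ?_⟩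
    have hm : (i + a) % (n + 1) < n + 1 := Nat.mod_lt _ (by omega)
    rw [← rot_rot, ← hF, ear_rot, H _ (by omega)]
    have := mod_cases (n := n + 1) (x := i + a) (by omega)
    omega

end MinBlk

/-- Among the four ends of two crossing edges there are two cyclically neighbouring vertices of
the polygon whose ears both belong to `E`. -/
def CrossAdj (n : ℕ) (E : ℕ → ℕ → Prop) : Prop :=
  ∀ a b c d, a < b → b < c → c < d → d < n → E a c → E b d →
    (b = a + 1 ∧ ear n E a ∧ ear n E b) ∨ (c = b + 1 ∧ ear n E b ∧ ear n E c) ∨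
    (d = c + 1 ∧ ear n E c ∧ ear n E d) ∨ (a = 0 ∧ d + 1 = n ∧ ear n E a ∧ ear n E d)

theorem CrossAdj.congr {n : ℕ} {E E' : ℕ → ℕ → Prop}
    (hE : ∀ i j, i < n → j < n → (E i j ↔ E' i j)) (h : CrossAdj n E) : CrossAdj n E' := by
  intro a b c d hab hbc hcd hd h1 h2
  have := h a b c d hab hbc hcd hd ((hE _ _ (by omega) (by omega)).2 h1)
    ((hE _ _ (by omega) (by omega)).2 h2)
  simpa only [ear_congr (show 0 < n by omega) hE] using this

theorem CrossAdj.rot_one {n : ℕ} {E : ℕ → ℕ → Prop} (hE : ∀ i j, E i j → E j i)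
    (h : CrossAdj n E) : CrossAdj n (rot n 1 E) := by
  intro a b c d hab hbc hcd hd h1 h2
  simp only [rot] at h1 h2
  simp only [ear_rot]
  rw [Nat.mod_eq_of_lt (show a + 1 < n by omega)] at h1 ⊢
  rw [Nat.mod_eq_of_lt (show c + 1 < n by omega)] at h1 ⊢
  rw [Nat.mod_eq_of_lt (show b + 1 < n by omega)] at h2 ⊢
  rcases add_one_mod_cases hd with ⟨hd', e⟩ | ⟨hd', e⟩ <;> rw [e] at h2 ⊢
  · rcases h _ _ _ _ (by omega) (by omega) (by omega) hd' h1 h2 with h3 | h3 | h3 | h3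
    · exact Or.inl ⟨by omega, h3.2⟩
    · exact Or.inr (Or.inl ⟨by omega, h3.2⟩)
    · exact Or.inr (Or.inr (Or.inl ⟨by omega, h3.2⟩))
    · omega
  · rcases h 0 _ _ _ (by omega) (by omega) (by omega) (show c + 1 < n by omega) (hE _ _ h2) h1
      with h3 | h3 | h3 | h3
    · exact Or.inr (Or.inr (Or.inr ⟨by omega, hd', h3.2.2, h3.2.1⟩))
    · exact Or.inl ⟨by omega, h3.2⟩
    · exact Or.inr (Or.inl ⟨by omega, h3.2⟩)
    · exact Or.inr (Or.inr (Or.inl ⟨by omega, h3.2.2.2, h3.2.2.1⟩))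

theorem CrossAdj.rot {n : ℕ} {E : ℕ → ℕ → Prop} (hE : ∀ i j, E i j → E j i) (h : CrossAdj n E)
    (r : ℕ) : CrossAdj n (rot n r E) := by
  refine (rot_induction (n := n) (P := fun E => (∀ i j, E i j → E j i) ∧ CrossAdj n E)
    ?_ ?_ ⟨hE, h⟩ r).2
  · exact fun E h => ⟨rot_symm h.1,
      h.2.congr fun i j hi hj => (rot_of_dvd (dvd_zero n) E hi hj).symm⟩
  · exact fun E h => ⟨rot_symm h.1, h.2.rot_one h.1⟩

theorem MinBlk.crossAdj {n : ℕ} (hn : 4 ≤ n) : ∀ {E : ℕ → ℕ → Prop}, MinBlk n E →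
    CrossAdj n E := by
  induction n, hn using Nat.le_induction with
  | base =>
    intro E h a b c d hab hbc hcd hd _ _
    have hall : ∀ i, i < 4 → ear 4 E i := fun i hi => by
      by_contra hcon
      rw [← ear_of_rot_last hi] at hcon
      exact absurd ((h.blk.rot (i + 1)).restrict (rot_symm h.symm) hcon).four_le (by omega)
    exact Or.inl ⟨by omega, hall a (by omega), hall b (by omega)⟩
  | succ n hn ih =>
    intro E h
    obtain ⟨r, s, hs, hsn, H⟩ := h.exists_ears_interval (by omega)
    suffices hX : CrossAdj (n + 1) (_root_.rot (n + 1) r E) by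
      have := hX.rot (rot_symm h.symm) ((n + 1) * r - r)
      rw [rot_rot, Nat.sub_add_cancel (Nat.le_mul_of_pos_left _ (by omega))] at this
      exact this.congr fun i j hi hj => rot_of_dvd (Dvd.intro _ rfl) E hi hj
    have h1 := h.rot r
    set F := _root_.rot (n + 1) r E with hF
    have hlast : ¬ear (n + 1) F n := by rw [H n (by omega)]; omega
    have hpre : ¬ear (n + 1) F (n - 1) := by rw [H (n - 1) (by omega)]; omega
    have h0 : F n 1 := (ear_zero (by omega)).1 ((H 0 (by omega)).2 (by omega))
    have mid : ∀ i, 1 ≤ i → i + 1 < n → ear n F i → i < s := fun i hi1 hi2 he => by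
      rw [← H i (by omega), ear_mid hi1 (by omega)]; exact (ear_mid hi1 hi2).1 he
    have present : ∀ i, i < s → ear (n + 1) F i := fun i hi => (H i (by omega)).2 hi
    intro a b c d hab hbc hcd hd hac hbd
    rcases Nat.lt_or_ge d n with hdn | hdn
    · rcases ih (h1.restrict hlast).1 a b c d hab hbc hcd hdn hac hbd with h3 | h3 | h3 | h3
      · have hb := mid b (by omega) (by omega) h3.2.2
        exact Or.inl ⟨h3.1, present a (by omega), present b hb⟩
      · have hc := mid c (by omega) (by omega) h3.2.2
        exact Or.inr (Or.inl ⟨h3.1, present b (by omega), present c hc⟩)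
      · have hc := mid c (by omega) (by omega) h3.2.1
        rcases Nat.lt_or_ge (d + 1) n with hd1 | hd1
        · exact Or.inr (Or.inr (Or.inl
            ⟨h3.1, present c hc, present d (mid d (by omega) hd1 h3.2.2)⟩))
        · -- here `n - 2` is the last vertex with an ear, so the neighbour of `n - 1` is `n - 3`
          have h4 : F (n - 2 - 1) (n - 2 + 1) :=
            (ear_mid (by omega) (by omega)).1 (present (n - 2) (by omega))
          have h5 := h1.unique_neighbor (v := n - 1) (by omega) hpre (x := n - 2 - 1) (y := b)
            (by omega) (by omega)
            (h1.symm _ _ (by rwa [show n - 2 + 1 = n - 1 by omega] at h4)) (by omega) (by omega)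
            (h1.symm _ _ (by rwa [show d = n - 1 by omega] at hbd))
          exact Or.inr (Or.inl ⟨by omega, present b (by omega), present c hc⟩)
      · -- the neighbour of `n - 1` is `1`
        have h4 : F (n - 1) 1 := by
          have := h3.2.2.1
          rwa [h3.1, ear_zero (by omega)] at this
        have h5 := h1.unique_neighbor (v := n - 1) (by omega) hpre (x := 1) (y := b)
            (by omega) (by omega) h4 (by omega) (by omega)
            (h1.symm _ _ (by rwa [show d = n - 1 by omega] at hbd))
        exact Or.inl ⟨by omega, present a (by omega), present b (by omega)⟩
    · obtain rfl : d = n := by omega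
      have h5 := h1.unique_neighbor d.lt_succ_self hlast (x := 1) (y := b) (by omega) (by omega) h0
        (by omega) (by omega) (h1.symm _ _ hbd)
      exact Or.inl ⟨by omega, present a (by omega), present b (by omega)⟩

/-! ### A sufficient condition for blocking -/

/-- The order preserving labelling of the vertices other than `v`. -/
def skip (v i : ℕ) : ℕ := if i < v then i else i + 1

theorem skip_cases (v i : ℕ) : (i < v ∧ skip v i = i) ∨ (v ≤ i ∧ skip v i = i + 1) := by
  unfold skip; split_ifs with h
  · exact Or.inl ⟨h, rfl⟩
  · exact Or.inr ⟨not_lt.1 h, rfl⟩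

/-- Instead of cutting off the last vertex after a rotation, one may cut off any vertex and close
the gap in the labels. -/
theorem Blk.of_skip {n : ℕ} {E : ℕ → ℕ → Prop} (hE : ∀ i j, E i j → E j i) (hn : 3 ≤ n)
    (h : ∀ v, v ≤ n → ear (n + 1) E v ∨ Blk n fun i j => E (skip v i) (skip v j)) :
    Blk (n + 1) E := by
  refine ⟨hn, fun r => ?_⟩
  set v := (n + r) % (n + 1) with hv
  have hvn : v < n + 1 := Nat.mod_lt _ (by omega)
  rcases h v (by omega) with h1 | h1
  · left
    rw [← ear_rot, ear_last (by omega) rfl] at h1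
    exact rot_symm hE _ _ h1
  · right
    refine (h1.rot v).congr fun i j hi hj => ?_
    have key : ∀ i, i < n → skip v ((i + v) % n) = (i + r) % (n + 1) := by
      intro i hi
      have e : (i + r) % (n + 1) = (i + (v + 1)) % (n + 1) := by
        rw [show i + (v + 1) = v + (i + 1) by omega, hv, Nat.mod_add_mod,
          show n + r + (i + 1) = i + r + (n + 1) by omega, Nat.add_mod_right]
      rw [e]
      have h2 := mod_cases (n := n) (x := i + v) (by omega)
      have h3 := mod_cases (n := n + 1) (x := i + (v + 1)) (by omega)
      have h4 := skip_cases v ((i + v) % n)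
      omega
    simp only [_root_.rot, key i hi, key j hj]

/-- The edges `{π j, j}` for `2 ≤ j < n` join each vertex `j` to an earlier one, not the preceding
one; if two of them cross, then their earlier ends are consecutive; and the last vertex is not
joined to the vertex `0`. -/
structure RootedBy (n : ℕ) (π : ℕ → ℕ) (E : ℕ → ℕ → Prop) : Prop where
  symm : ∀ i j, E i j → E j i
  edge_iff : ∀ i j, i < j → j < n → (E i j ↔ 2 ≤ j ∧ π j = i)
  le : ∀ j, 2 ≤ j → j < n → π j + 2 ≤ j
  last : 1 ≤ π (n - 1)
  cross : ∀ i j, 2 ≤ i → i < j → j < n → π i < π j → π j < i → π j = π i + 1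

namespace RootedBy

variable {n : ℕ} {π : ℕ → ℕ} {E : ℕ → ℕ → Prop}

/-- The edges `{π i, i}` with `i` at most one past the neighbour of the last vertex `n` are all of
the form `{i - 2, i}`: by descent on `i`, since each of them would otherwise cross the next one in
a forbidden way. -/
theorem eq_sub_two (h : RootedBy (n + 1) π E) (hn : 3 ≤ n) :
    ∀ i, 2 ≤ i → i ≤ π n + 1 → π i + 2 = i := by
  have hlast := h.le n (by omega) (by omega)
  suffices H : ∀ d i, 2 ≤ i → i + d = π n + 1 → π i + 2 = i from
    fun i hi hin => H (π n + 1 - i) i hi (by omega)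
  intro d
  induction d with
  | zero =>
    intro i hi hd
    have h3 := h.le i hi (by omega)
    have := h.cross i n hi (by omega) (by omega) (by omega) (by omega)
    omega
  | succ d ih =>
    intro i hi hd
    have h3 := h.le i hi (by omega)
    have h4 := ih (i + 1) (by omega) (by omega)
    have := h.cross i (i + 1) hi (by omega) (by omega) (by omega) (by omega)
    omega

/-- Cutting off the first vertex. -/
theorem skip_zero (h : RootedBy (n + 1) π E) (hn : 3 ≤ n) (hear : ¬ear (n + 1) E 0) :
    RootedBy n (fun j => π (j + 1) - 1) fun i j => E (skip 0 i) (skip 0 j) := by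
  have hlast := h.le n (by omega) (by omega)
  have h2 : 2 ≤ π n := by
    by_contra hcon
    apply hear
    rw [ear_zero (by omega)]
    have := h.last
    rw [Nat.add_sub_cancel] at this ⊢
    exact h.symm _ _ ((h.edge_iff 1 n (by omega) (by omega)).2 ⟨by omega, by omega⟩)
  have pos : ∀ j, 3 ≤ j → j < n + 1 → 1 ≤ π j := by
    intro j hj hjn
    by_contra hcon
    rcases Nat.lt_or_ge (π n + 1) j with h3 | h3
    · rcases Nat.lt_or_ge j n with h4 | h4
      · have := h.cross j n (by omega) h4 (by omega) (by omega) (by omega)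
        omega
      · obtain rfl : j = n := by omega
        omega
    · have := h.eq_sub_two hn j (by omega) h3
      omega
  have hskip : ∀ i, skip 0 i = i + 1 := fun i => by have := skip_cases 0 i; omega
  refine ⟨fun i j => h.symm _ _, fun i j hij hj => ?_, fun j hj hjn => ?_, ?_, ?_⟩
  · simp only [hskip]
    rw [h.edge_iff _ _ (by omega) (by omega)]
    constructor
    · rintro ⟨h3, h4⟩
      have := h.le (j + 1) (by omega) (by omega)
      omega
    · rintro ⟨h3, h4⟩
      have := pos (j + 1) (by omega) (by omega)
      omega
  · have := h.le (j + 1) (by omega) (by omega)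
    have := pos (j + 1) (by omega) (by omega)
    omega
  · simp only [Nat.sub_add_cancel (show 1 ≤ n by omega)]
    omega
  · intro i j hi hij hj h3 h4
    have p1 := pos (i + 1) (by omega) (by omega)
    have p2 := pos (j + 1) (by omega) (by omega)
    have := h.cross (i + 1) (j + 1) (by omega) (by omega) (by omega) (by omega) (by omega)
    omega

/-- Cutting off a vertex other than the first two: it is nobody's earlier neighbour. -/
theorem skip_of_two_le (h : RootedBy (n + 1) π E) (hn : 3 ≤ n) {v : ℕ} (hv : 2 ≤ v) (hvn : v ≤ n)
    (hear : ¬ear (n + 1) E v) :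
    RootedBy n (fun j => if π (skip v j) < v then π (skip v j) else π (skip v j) - 1)
      fun i j => E (skip v i) (skip v j) := by
  have next : v < n → π (v + 1) + 2 ≤ v := by
    intro h1
    have h2 := h.le (v + 1) (by omega) (by omega)
    by_contra hcon
    apply hear
    rw [ear_mid (by omega) (by omega)]
    exact (h.edge_iff _ _ (by omega) (by omega)).2 ⟨by omega, by omega⟩
  have childless : ∀ j, 2 ≤ j → j < n + 1 → π j ≠ v := by
    intro j hj hjn hcon
    have h1 := h.le j hj hjn
    have h2 := next (by omega)
    rcases Nat.eq_or_lt_of_le (show v + 1 ≤ j by omega) with rfl | h3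
    · omega
    · have := h.cross (v + 1) j (by omega) h3 hjn (by omega) (by omega)
      omega
  have spec : ∀ j, 2 ≤ j → j < n →
      2 ≤ skip v j ∧ skip v j < n + 1 ∧ π (skip v j) ≠ v ∧ π (skip v j) + 2 ≤ skip v j := by
    intro j hj hjn
    have h1 := skip_cases v j
    have h2 : 2 ≤ skip v j ∧ skip v j < n + 1 := by omega
    exact ⟨h2.1, h2.2, childless _ h2.1 h2.2, h.le _ h2.1 h2.2⟩
  have parent : ∀ x, ((x < v) ∧ (if x < v then x else x - 1) = x) ∨
      (v ≤ x ∧ (if x < v then x else x - 1) = x - 1) := by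
    intro x; split_ifs with h1
    · exact Or.inl ⟨h1, rfl⟩
    · exact Or.inr ⟨not_lt.1 h1, rfl⟩
  refine ⟨fun i j => h.symm _ _, fun i j hij hj => ?_, fun j hj hjn => ?_, ?_, ?_⟩
  · have hi := skip_cases v i
    have hj' := skip_cases v j
    have hp := parent (π (skip v j))
    rw [h.edge_iff _ _ (by omega) (by omega)]
    constructor
    · rintro ⟨h3, h4⟩
      have h5 := h.le (skip v j) h3 (by omega)
      exact ⟨by omega, by omega⟩
    · rintro ⟨h3, h4⟩
      have := spec j h3 hj
      exact ⟨by omega, by omega⟩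
  · have := spec j hj hjn
    have hp := parent (π (skip v j))
    have hj' := skip_cases v j
    -- the label `v` now denotes the vertex after the removed one; it is not joined to `v - 1`,
    -- because the ear at `v` is missing
    by_cases hjv : j = v
    · subst hjv
      have e : skip j j = j + 1 := by omega
      rw [e] at this hp
      have := next hjn
      simp only [e]
      omega
    · omega
  · have hj' := skip_cases v (n - 1)
    have := spec (n - 1) (by omega) (by omega)
    have hp := parent (π (skip v (n - 1)))
    have hlast := h.last
    rw [Nat.add_sub_cancel] at hlast
    rcases Nat.eq_or_lt_of_le hvn with rfl | h1
    · rw [show skip v (v - 1) = v - 1 by omega] at *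
      -- otherwise the ear at the last vertex is present
      by_contra hcon
      apply hear
      rw [ear_last (by omega) rfl]
      exact h.symm _ _ ((h.edge_iff 0 (v - 1) (by omega) (by omega)).2 ⟨by omega, by omega⟩)
    · rw [show skip v (n - 1) = n by omega] at *
      omega
  · intro i j hi hij hj h3 h4
    have si := spec i hi (by omega)
    have sj := spec j (by omega) hj
    have hi' := skip_cases v i
    have hj' := skip_cases v j
    have pi := parent (π (skip v i))
    have pj := parent (π (skip v j))
    have := h.cross (skip v i) (skip v j) si.1 (by omega) sj.2.1 (by omega) (by omega)
    omega

theorem blk (hn : 3 ≤ n) : ∀ {π : ℕ → ℕ} {E : ℕ → ℕ → Prop}, RootedBy n π E → Blk n E := by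
  induction n, hn using Nat.le_induction with
  | base =>
    intro π E h
    have := h.le 2 le_rfl (by omega)
    have h2 : 1 ≤ π 2 := h.last
    omega
  | succ n hn ih =>
    intro π E h
    refine Blk.of_skip h.symm hn fun v hv => ?_
    by_cases hear : ear (n + 1) E v
    · exact Or.inl hear
    right
    rcases (show v = 0 ∨ v = 1 ∨ 2 ≤ v by omega) with rfl | rfl | h2
    · exact ih (h.skip_zero hn hear)
    · refine absurd ?_ hear
      rw [ear_mid le_rfl (by omega)]
      have := h.le 2 le_rfl (by omega)
      exact (h.edge_iff 0 2 (by omega) (by omega)).2 ⟨le_rfl, by omega⟩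
    · exact ih (h.skip_of_two_le hn h2 hv hear)

end RootedBy

/-! ### Counting words -/

/-- The words `g` of length `k` with letters at most `t + 1` in which no letter exceeds an earlier
one by more than `1`. -/
def tails (t : ℕ) : ℕ → Finset (List ℕ)
  | 0 => {[]}
  | k + 1 => ((Finset.range (t + 1)).biUnion fun h => (tails h k).image (List.cons h)) ∪
      (tails t k).image (List.cons (t + 1))

/-- The words `g` of length `k` with first letter less than `t` in which no letter exceeds an
earlier one by more than `1`. -/
def words (t : ℕ) : ℕ → Finset (List ℕ)
  | 0 => {[]}
  | k + 1 => (Finset.range t).biUnion fun h => (tails h k).image (List.cons h)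

theorem mem_tails {k : ℕ} : ∀ {t : ℕ} {g : List ℕ}, g ∈ tails t k ↔
    g.length = k ∧ g.Pairwise (fun x y => y ≤ x + 1) ∧ ∀ x ∈ g, x ≤ t + 1 := by
  induction k with
  | zero =>
    intro t g
    simp only [tails, Finset.mem_singleton, List.length_eq_zero_iff]
    constructor
    · rintro rfl; simp
    · exact fun h => h.1
  | succ k ih =>
    intro t g
    simp only [tails, Finset.mem_union, Finset.mem_biUnion, Finset.mem_range, Finset.mem_image, ih]
    constructor
    · rintro (⟨h, hh, r, ⟨h1, h2, h3⟩, rfl⟩ | ⟨r, ⟨h1, h2, h3⟩, rfl⟩)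
      · refine ⟨by simp [h1], List.pairwise_cons.2 ⟨h3, h2⟩, fun x hx => ?_⟩
        rcases List.mem_cons.1 hx with rfl | hx
        · omega
        · have := h3 x hx; omega
      · refine ⟨by simp [h1], List.pairwise_cons.2 ⟨fun x hx => ?_, h2⟩, fun x hx => ?_⟩
        · have := h3 x hx; omega
        · rcases List.mem_cons.1 hx with rfl | hx
          · omega
          · exact h3 x hx
    · rintro ⟨h1, h2, h3⟩
      cases g with
      | nil => simp at h1
      | cons h r =>
        rw [List.pairwise_cons] at h2
        have h4 := h3 h List.mem_cons_self
        rw [List.length_cons, Nat.add_right_cancel_iff] at h1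
        rcases Nat.lt_or_ge h (t + 1) with h5 | h5
        · exact Or.inl ⟨h, h5, r, ⟨h1, h2.2, h2.1⟩, rfl⟩
        · obtain rfl : h = t + 1 := by omega
          exact Or.inr ⟨r, ⟨h1, h2.2, fun x hx => h3 x (List.mem_cons_of_mem _ hx)⟩, rfl⟩

theorem mem_words {t k : ℕ} {g : List ℕ} : g ∈ words t k ↔
    g.length = k ∧ g.Pairwise (fun x y => y ≤ x + 1) ∧ ∀ x ∈ g.head?, x < t := by
  cases k with
  | zero =>
    simp only [words, Finset.mem_singleton, List.length_eq_zero_iff]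
    constructor
    · rintro rfl; simp
    · exact fun h => h.1
  | succ k =>
    simp only [words, Finset.mem_biUnion, Finset.mem_range, Finset.mem_image, mem_tails]
    constructor
    · rintro ⟨h, hh, r, ⟨h1, h2, h3⟩, rfl⟩
      exact ⟨by simp [h1], List.pairwise_cons.2 ⟨h3, h2⟩, by simpa using hh⟩
    · rintro ⟨h1, h2, h3⟩
      cases g with
      | nil => simp at h1
      | cons h r =>
        rw [List.pairwise_cons] at h2
        rw [List.length_cons, Nat.add_right_cancel_iff] at h1
        exact ⟨h, by simpa using h3, r, ⟨h1, h2.2, h2.1⟩, rfl⟩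

theorem card_biUnion_cons (t k : ℕ) :
    ((Finset.range t).biUnion fun h => (tails h k).image (List.cons h)).card =
      ∑ h ∈ Finset.range t, (tails h k).card := by
  rw [Finset.card_biUnion]
  · exact Finset.sum_congr rfl fun h _ =>
      Finset.card_image_of_injective _ List.cons_injective
  · intro a _ b _ hab
    refine Finset.disjoint_left.2 fun g hg hg' => ?_
    obtain ⟨r, -, rfl⟩ := Finset.mem_image.1 hg
    obtain ⟨r', -, h⟩ := Finset.mem_image.1 hg'
    exact hab (List.cons.inj h).1.symm

theorem card_tails_zero (t : ℕ) : (tails t 0).card = 1 := Finset.card_singleton _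

theorem card_words_zero (t : ℕ) : (words t 0).card = 1 := Finset.card_singleton _

theorem card_words_succ (t k : ℕ) :
    (words t (k + 1)).card = ∑ h ∈ Finset.range t, (tails h k).card :=
  card_biUnion_cons t k

theorem card_tails_succ (t k : ℕ) : (tails t (k + 1)).card =
    ∑ h ∈ Finset.range (t + 1), (tails h k).card + (tails t k).card := by
  rw [tails, Finset.card_union_of_disjoint, card_biUnion_cons,
    Finset.card_image_of_injective _ List.cons_injective]
  rw [Finset.disjoint_left]
  intro g hg hg'
  obtain ⟨h, hh, hg⟩ := Finset.mem_biUnion.1 hg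
  obtain ⟨r, -, rfl⟩ := Finset.mem_image.1 hg
  obtain ⟨r', -, h'⟩ := Finset.mem_image.1 hg'
  have := (List.cons.inj h').1
  have := Finset.mem_range.1 hh
  omega

/-- The sums of the numbers of words and of tails along an antidiagonal satisfy the recursion of
the Fibonacci numbers of odd and of even index. -/
theorem sum_card_tails (m : ℕ) :
    ∑ x ∈ Finset.HasAntidiagonal.antidiagonal m, (tails x.1 x.2).card = Nat.fib (2 * m + 2) ∧
      1 + ∑ x ∈ Finset.HasAntidiagonal.antidiagonal m,
        ∑ h ∈ Finset.range (x.1 + 1), (tails h x.2).card = Nat.fib (2 * m + 3) := by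
  induction m with
  | zero => simp [card_tails_zero, Nat.fib_add_two]
  | succ m ih =>
    have h1 : ∑ x ∈ Finset.HasAntidiagonal.antidiagonal (m + 1), (tails x.1 x.2).card =
        Nat.fib (2 * (m + 1) + 2) := by
      rw [Finset.Nat.sum_antidiagonal_succ']
      simp only [card_tails_zero, card_tails_succ, Finset.sum_add_distrib]
      have h2 : Nat.fib (2 * (m + 1) + 2) = Nat.fib (2 * m + 2) + Nat.fib (2 * m + 3) :=
        Nat.fib_add_two
      rw [ih.1, h2, ← ih.2]
      ring
    refine ⟨h1, ?_⟩
    simp only [Finset.sum_range_succ _ (Prod.fst _), Finset.sum_add_distrib]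
    rw [h1, Finset.Nat.sum_antidiagonal_succ]
    simp only [Finset.range_zero, Finset.sum_empty, zero_add]
    have h2 : Nat.fib (2 * (m + 1) + 3) = Nat.fib (2 * m + 3) + Nat.fib (2 * (m + 1) + 2) :=
      Nat.fib_add_two
    rw [h2, ← ih.2]
    ring

/-- The pairs of `t ≥ 1` and a word `g` with first letter less than `t` such that
`t + g.length = m + 1`. -/
def sizedWords (m : ℕ) : Finset (ℕ × List ℕ) :=
  (Finset.HasAntidiagonal.antidiagonal m).biUnion fun x =>
    (words (x.1 + 1) x.2).image (Prod.mk (x.1 + 1))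

theorem mem_sizedWords {m : ℕ} {c : ℕ × List ℕ} : c ∈ sizedWords m ↔
    1 ≤ c.1 ∧ c.1 + c.2.length = m + 1 ∧ c.2.Pairwise (fun x y => y ≤ x + 1) ∧
      ∀ x ∈ c.2.head?, x < c.1 := by
  simp only [sizedWords, Finset.mem_biUnion, Finset.HasAntidiagonal.mem_antidiagonal,
    Finset.mem_image, mem_words]
  constructor
  · rintro ⟨⟨a, k⟩, h1, g, ⟨h2, h3, h4⟩, rfl⟩
    dsimp only at *
    exact ⟨by omega, by omega, h3, h4⟩
  · rintro ⟨h1, h2, h3, h4⟩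
    obtain ⟨t, g⟩ := c
    dsimp only at *
    have e : t - 1 + 1 = t := by omega
    exact ⟨(t - 1, g.length), by dsimp only; omega, g, ⟨rfl, h3, by rwa [e]⟩, by rw [e]⟩

theorem card_sizedWords (m : ℕ) : (sizedWords m).card = Nat.fib (2 * m + 1) := by
  have h1 : (sizedWords m).card =
      ∑ x ∈ Finset.HasAntidiagonal.antidiagonal m, (words (x.1 + 1) x.2).card := by
    rw [sizedWords, Finset.card_biUnion]
    · exact Finset.sum_congr rfl fun x _ =>
        Finset.card_image_of_injective _ (Prod.mk_right_injective _)
    · intro x hx y hy hxy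
      refine Finset.disjoint_left.2 fun c hc hc' => ?_
      obtain ⟨g, -, rfl⟩ := Finset.mem_image.1 hc
      obtain ⟨g', -, h⟩ := Finset.mem_image.1 hc'
      have h2 := (Prod.mk.inj h).1
      have hx := Finset.HasAntidiagonal.mem_antidiagonal.1 hx
      have hy := Finset.HasAntidiagonal.mem_antidiagonal.1 hy
      exact hxy (Prod.ext (by omega) (by omega))
  rw [h1]
  cases m with
  | zero => simp [card_words_zero]
  | succ m =>
    rw [Finset.Nat.sum_antidiagonal_succ']
    simp only [card_words_zero, card_words_succ]
    rw [show 2 * (m + 1) + 1 = 2 * m + 3 by ring, ← (sum_card_tails m).2, add_comm]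

/-- The sized words whose last letter is not `0`. -/
def codes (m : ℕ) : Finset (ℕ × List ℕ) :=
  (sizedWords m).filter fun c => c.2.getLast? ≠ some 0

/-- A letter `0` may always be appended to a word, so the words that end in `0` correspond to the
words that are shorter by one letter. -/
theorem card_codes (m : ℕ) : (codes m).card = fibF (2 * m) := by
  have h1 := Finset.card_filter_add_card_filter_not (s := sizedWords m)
    (fun c => c.2.getLast? ≠ some 0)
  rw [card_sizedWords] at h1
  change (codes m).card + _ = _ at h1
  cases m with
  | zero =>
    have h2 : (sizedWords 0).filter (fun c => ¬c.2.getLast? ≠ some 0) = ∅ := by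
      rw [Finset.filter_eq_empty_iff]
      intro c hc
      have := mem_sizedWords.1 hc
      have h3 : c.2 = [] := List.length_eq_zero_iff.1 (by omega)
      simp [h3]
    rw [h2] at h1
    simpa [fibF] using h1
  | succ m =>
    have h2 : (sizedWords (m + 1)).filter (fun c => ¬c.2.getLast? ≠ some 0) =
        (sizedWords m).image fun c => (c.1, c.2 ++ [0]) := by
      ext ⟨t, g⟩
      simp only [Finset.mem_filter, not_not, Finset.mem_image, Prod.mk.injEq, Prod.exists]
      constructor
      · rintro ⟨hc, h3⟩
        obtain ⟨g, rfl⟩ := List.getLast?_eq_some_iff.1 h3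
        refine ⟨t, g, ?_, rfl, rfl⟩
        rw [mem_sizedWords] at hc ⊢
        obtain ⟨a1, a2, a3, a4⟩ := hc
        dsimp only at *
        rw [List.length_append, List.length_singleton] at a2
        refine ⟨a1, by omega, (List.pairwise_append.1 a3).1, fun x hx => a4 x ?_⟩
        rw [List.head?_append, Option.mem_def.1 hx]; rfl
      · rintro ⟨t, g, hc, rfl, rfl⟩
        rw [mem_sizedWords] at hc ⊢
        obtain ⟨a1, a2, a3, a4⟩ := hc
        dsimp only at *
        refine ⟨⟨a1, by rw [List.length_append, List.length_singleton]; omega, ?_, ?_⟩, by simp⟩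
        · rw [List.pairwise_append]
          exact ⟨a3, by simp, by simp⟩
        · cases g with
          | nil => simpa using Nat.pos_of_ne_zero (by omega)
          | cons x g => simpa using a4
    rw [h2, Finset.card_image_of_injective, card_sizedWords] at h1
    · rw [fibF, if_neg (by omega), show 2 * (m + 1) = 2 * m + 2 by ring]
      rw [show 2 * (m + 1) + 1 = 2 * m + 1 + 2 by ring, Nat.fib_add_two] at h1
      rw [show 2 * m + 2 = 2 * m + 1 + 1 by ring]
      omega
    · rintro ⟨t, g⟩ ⟨t', g'⟩ h
      obtain ⟨h, h'⟩ := Prod.mk.inj h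
      exact Prod.ext h (List.append_cancel_right h')

/-! ### Triangulations of the polygon -/

section
variable {n : ℕ}

theorem Sym2.exists_lt_of_not_isDiag (e : Sym2 (Fin n)) (he : ¬e.IsDiag) :
    ∃ i j, i < j ∧ e = s(i, j) := by
  induction e using Sym2.inductionOn with
  | hf a b =>
    rcases lt_trichotomy a b with h | h | h
    · exact ⟨a, b, h, rfl⟩
    · exact absurd (by simpa using h) he
    · exact ⟨b, a, h, Sym2.eq_swap⟩

theorem isDiagonal_iff {i j : Fin n} (hij : i < j) :
    IsDiagonal s(i, j) ↔ (i : ℕ) + 2 ≤ j ∧ (0 < (i : ℕ) ∨ (j : ℕ) + 1 < n) := by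
  have h1 : (i : ℕ) < j := hij
  have h2 := j.isLt
  simp only [IsDiagonal, edgeOrder, Sym2.lift_mk]
  omega

theorem IsDiagonal.not_isDiag {e : Sym2 (Fin n)} (he : IsDiagonal e) : ¬e.IsDiag := by
  induction e using Sym2.inductionOn with
  | hf a b =>
    rintro h
    obtain rfl : a = b := by simpa using h
    simp [IsDiagonal, edgeOrder] at he

theorem isDiagonal_of_interleave {i j b d : Fin n} (hib : i < b) (hbj : b < j)
    (hd : d < i ∨ j < d) : IsDiagonal s(b, d) ∧ IsDiagonal s(i, j) ∧ b ≠ d ∧ s(i, j) ≠ s(b, d) := by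
  have h1 : (i : ℕ) < b := hib
  have h2 : (b : ℕ) < j := hbj
  have h3 : (d : ℕ) < i ∨ (j : ℕ) < d := hd
  have h4 := d.isLt
  have h5 := j.isLt
  refine ⟨?_, (isDiagonal_iff (hib.trans hbj)).2 (by omega), ?_, ?_⟩
  · rcases h3 with h3 | h3
    · rw [Sym2.eq_swap]
      exact (isDiagonal_iff (show d < b from h3.trans h1)).2 (by omega)
    · exact (isDiagonal_iff (show b < d from h2.trans h3)).2 (by omega)
  · rintro rfl; omega
  · intro h
    rcases Sym2.eq_iff.1 h with ⟨rfl, rfl⟩ | ⟨rfl, rfl⟩ <;> omega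

variable {p : Fin n → Plane}

theorem Cross.symm {e f : Sym2 (Fin n)} (h : Cross p e f) : Cross p f e := by
  unfold Cross at *; rwa [Set.inter_comm]

/-- A set of edges as a relation between natural numbers. -/
def edgeRel (B : Finset (Sym2 (Fin n))) (i j : ℕ) : Prop :=
  ∃ (hi : i < n) (hj : j < n), s((⟨i, hi⟩ : Fin n), (⟨j, hj⟩ : Fin n)) ∈ B

theorem edgeRel_symm (B : Finset (Sym2 (Fin n))) : ∀ i j, edgeRel B i j → edgeRel B j i := by
  rintro i j ⟨hi, hj, h⟩
  exact ⟨hj, hi, by rwa [Sym2.eq_swap]⟩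

theorem edgeRel_fin {B : Finset (Sym2 (Fin n))} {i j : Fin n} :
    edgeRel B i j ↔ s(i, j) ∈ B :=
  ⟨fun ⟨_, _, h⟩ => h, fun h => ⟨i.isLt, j.isLt, h⟩⟩

/-- The diagonals of a combinatorial triangulation form a triangulation. -/
theorem IsTri.exists_isTriangulation (hp : IsClockwiseConvexPolygon p) {T : ℕ → ℕ → Prop}
    (hT : IsTri n T) : ∃ T' : Finset (Sym2 (Fin n)), IsTriangulation p T' ∧
      ∀ i j : Fin n, s(i, j) ∈ T' → IsDiagonal s(i, j) ∧ T i j := by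
  classical
  let T' : Finset (Sym2 (Fin n)) :=
    Finset.univ.filter fun e => IsDiagonal e ∧ ∃ i j : Fin n, e = s(i, j) ∧ T i j
  have mem : ∀ i j : Fin n, s(i, j) ∈ T' ↔ IsDiagonal s(i, j) ∧ T i j := by
    intro i j
    simp only [T', Finset.mem_filter, Finset.mem_univ, true_and]
    refine and_congr_right fun _ => ⟨?_, fun h => ⟨i, j, rfl, h⟩⟩
    rintro ⟨a, b, h, hab⟩
    rcases Sym2.eq_iff.1 h with ⟨rfl, rfl⟩ | ⟨rfl, rfl⟩
    · exact hab
    · exact hT.symm _ _ hab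
  refine ⟨T', ⟨⟨fun e he => (Finset.mem_filter.1 he).2.1, ?_⟩, ?_⟩, fun i j h => (mem i j).1 h⟩
  · intro e he f hf hef hcr
    obtain ⟨i, j, hij, rfl⟩ :=
      e.exists_lt_of_not_isDiag (Finset.mem_filter.1 he).2.1.not_isDiag
    obtain ⟨b, d, hbd, rfl⟩ :=
      f.exists_lt_of_not_isDiag (Finset.mem_filter.1 hf).2.1.not_isDiag
    have h1 := ((mem _ _).1 he).2
    have h2 := ((mem _ _).1 hf).2
    rcases (hp.cross_iff hij hbd.ne hef).1 hcr with ⟨h3, h4, h5⟩ | ⟨h3, h4, h5⟩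
    · have := hT.noncross i j b d h3 h4 j.isLt d.isLt h1 h2
      rcases h5 with h5 | h5 <;>
        [exact absurd h5 (not_lt.2 this.1); exact absurd h5 (not_lt.2 this.2)]
    · have := hT.noncross i j d b h3 h4 j.isLt b.isLt h1 (hT.symm _ _ h2)
      rcases h5 with h5 | h5 <;>
        [exact absurd h5 (not_lt.2 this.1); exact absurd h5 (not_lt.2 this.2)]
  · intro T2 hT2 hle e he
    obtain ⟨i, j, hij, rfl⟩ := e.exists_lt_of_not_isDiag (hT2.1 e he).not_isDiag
    refine (mem i j).2 ⟨hT2.1 _ he, hT.maximal i j hij j.isLt fun b d hd hib hbj hbd => ?_⟩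
    by_contra hcon
    have hb : b < n := hbj.trans j.isLt
    have hd' : (⟨d, hd⟩ : Fin n) < i ∨ j < (⟨d, hd⟩ : Fin n) := by
      simp only [Fin.lt_def]; omega
    have hib' : i < (⟨b, hb⟩ : Fin n) := hib
    have hbj' : (⟨b, hb⟩ : Fin n) < j := hbj
    obtain ⟨h1, -, h3, h4⟩ := isDiagonal_of_interleave hib' hbj' hd'
    exact hT2.2 _ he _ (hle ((mem _ _).2 ⟨h1, hbd⟩)) h4
      ((hp.cross_iff hij h3 h4).2 (Or.inl ⟨hib', hbj', hd'⟩))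

/-- A triangulation together with the sides is a combinatorial triangulation. -/
theorem IsTriangulation.isTri (hp : IsClockwiseConvexPolygon p) {T : Finset (Sym2 (Fin n))}
    (hT : IsTriangulation p T) : IsTri n fun i j => ∀ (hi : i < n) (hj : j < n),
      s((⟨i, hi⟩ : Fin n), (⟨j, hj⟩ : Fin n)) ∈ T ∨ ¬IsDiagonal s((⟨i, hi⟩ : Fin n), ⟨j, hj⟩) where
  symm i j h hj hi := by rw [Sym2.eq_swap]; exact h hi hj
  noncross i j b d hib hbj hj hd hij hbd := by
    by_contra hcon
    have hi : i < n := by omega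
    have hb : b < n := by omega
    have hd' : (⟨d, hd⟩ : Fin n) < ⟨i, hi⟩ ∨ (⟨j, hj⟩ : Fin n) < (⟨d, hd⟩ : Fin n) := by
      simp only [Fin.lt_def]; omega
    have hib' : (⟨i, hi⟩ : Fin n) < (⟨b, hb⟩ : Fin n) := hib
    have hbj' : (⟨b, hb⟩ : Fin n) < (⟨j, hj⟩ : Fin n) := hbj
    obtain ⟨h1, h2, h3, h4⟩ := isDiagonal_of_interleave hib' hbj' hd'
    exact hT.1.2 _ ((hij hi hj).resolve_right (not_not.2 h2)) _
      ((hbd hb hd).resolve_right (not_not.2 h1)) h4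
      ((hp.cross_iff (hib'.trans hbj') h3 h4).2 (Or.inl ⟨hib', hbj', hd'⟩))
  maximal i j hij hjn H hi hj := by
    classical
    by_cases hdiag : IsDiagonal s((⟨i, hi⟩ : Fin n), ⟨j, hj⟩)
    swap
    · exact Or.inr hdiag
    left
    have hij' : (⟨i, hi⟩ : Fin n) < ⟨j, hj⟩ := hij
    have key : ∀ f ∈ T, s((⟨i, hi⟩ : Fin n), ⟨j, hj⟩) ≠ f →
        ¬Cross p s((⟨i, hi⟩ : Fin n), ⟨j, hj⟩) f := by
      intro f hf hne hcr
      obtain ⟨b, d, hbd, rfl⟩ := f.exists_lt_of_not_isDiag (hT.1.1 f hf).not_isDiag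
      rcases (hp.cross_iff hij' hbd.ne hne).1 hcr with ⟨h3, h4, h5⟩ | ⟨h3, h4, h5⟩
      · have := H b d d.isLt h3 h4 fun _ _ => Or.inl hf
        simp only [Fin.lt_def] at h5; omega
      · have := H d b b.isLt h3 h4 fun _ _ => Or.inl (by rw [Sym2.eq_swap]; exact hf)
        simp only [Fin.lt_def] at h5; omega
    have hins : IsNonCrossingDiagonals p (insert s((⟨i, hi⟩ : Fin n), ⟨j, hj⟩) T) := by
      refine ⟨fun e he => ?_, fun e he f hf hef hcr => ?_⟩
      · rcases Finset.mem_insert.1 he with rfl | he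
        · exact hdiag
        · exact hT.1.1 e he
      · rcases Finset.mem_insert.1 he with rfl | he <;> rcases Finset.mem_insert.1 hf with rfl | hf
        · exact hef rfl
        · exact key f hf hef hcr
        · exact key e he hef.symm hcr.symm
        · exact hT.1.2 e he f hf hef hcr
    exact hT.2 hins (Finset.subset_insert _ _) (Finset.mem_insert_self _ _)

/-- A set of edges is blocking exactly if the recursion over ears says so. -/
theorem isBlockingSet_iff (hp : IsClockwiseConvexPolygon p) (hn : 3 ≤ n)
    {B : Finset (Sym2 (Fin n))} :
    IsBlockingSet p B ↔ (∀ e ∈ B, ¬e.IsDiag) ∧ Blk n (edgeRel B) := by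
  have hloop : ∀ e : Sym2 (Fin n), e ∈ (⊤ : SimpleGraph (Fin n)).edgeSet ↔ ¬e.IsDiag := by
    intro e; simp
  simp only [IsBlockingSet, hloop]
  refine and_congr_right fun hB => ⟨fun h => ?_, fun h T hT => ?_⟩
  · by_contra hcon
    obtain ⟨T, hT, hA⟩ := (not_blk_iff hn (edgeRel_symm B)).1 hcon
    obtain ⟨T', hT', hmem⟩ := hT.exists_isTriangulation hp
    obtain ⟨e, heB, heT⟩ := h T' hT'
    obtain ⟨i, j, hij, rfl⟩ := e.exists_lt_of_not_isDiag (hB e heB)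
    obtain ⟨h1, h2⟩ := hmem i j heT
    rw [isDiagonal_iff hij] at h1
    exact hA i j h1.1 j.isLt h1.2 h2 (edgeRel_fin.2 heB)
  · by_contra hcon
    push Not at hcon
    refine (not_blk_iff hn (edgeRel_symm B)).2 ⟨_, hT.isTri hp, ?_⟩ h
    rintro i j hij hj hd hTij ⟨hi, hj, hBij⟩
    refine hcon _ hBij ((hTij hi hj).resolve_right (not_not.2 ?_))
    exact (isDiagonal_iff (show (⟨i, hi⟩ : Fin n) < ⟨j, hj⟩ by simp only [Fin.lt_def]; omega)).2
      ⟨hij, hd⟩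

theorem degSum_edgeRel_le (B : Finset (Sym2 (Fin n))) : degSum n (edgeRel B) ≤ 2 * B.card := by
  classical
  obtain ⟨G, hG⟩ : ∃ G, G = SimpleGraph.fromEdgeSet (B : Set (Sym2 (Fin n))) := ⟨_, rfl⟩
  have h1 : ∀ i : Fin n, deg n (edgeRel B) i = G.degree i := by
    intro i
    rw [← SimpleGraph.card_neighborFinset_eq_degree, ← Finset.card_map Fin.valEmbedding, deg]
    congr 1
    ext j
    simp only [Finset.mem_filter, Finset.mem_range, Finset.mem_map, SimpleGraph.mem_neighborFinset,
      Fin.valEmbedding_apply, hG, SimpleGraph.fromEdgeSet_adj, Finset.mem_coe]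
    constructor
    · rintro ⟨hj, hji, h⟩
      refine ⟨⟨j, hj⟩, ⟨edgeRel_fin.1 h, ?_⟩, rfl⟩
      rintro rfl; exact hji rfl
    · rintro ⟨j, ⟨h1, h2⟩, rfl⟩
      exact ⟨j.isLt, fun h => h2 (Fin.ext h.symm), edgeRel_fin.2 h1⟩
  rw [degSum, Finset.sum_range, Finset.sum_congr rfl fun i _ => h1 i,
    G.sum_degrees_eq_twice_card_edges]
  refine Nat.mul_le_mul_left 2 (Finset.card_le_card fun e he => ?_)
  rw [SimpleGraph.mem_edgeFinset, hG, SimpleGraph.edgeSet_fromEdgeSet] at he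
  exact he.1

theorem IsBlockingSet.le_card (hp : IsClockwiseConvexPolygon p) (hn : 3 ≤ n)
    {B : Finset (Sym2 (Fin n))} (h : IsBlockingSet p B) : n - 2 ≤ B.card := by
  have h1 := ((isBlockingSet_iff hp hn).1 h).2.le_degSum hn (edgeRel_symm B)
  have h2 := degSum_edgeRel_le B
  omega

end

/-! ### Blockers from words -/

/-- The earlier neighbour of the vertex `j` in the blocker of the code `(t, g)`: the vertices up to
`t + 1` are joined by the edges `{j - 2, j}`, the vertices after that according to the letters of
`g`, and the last vertex is joined to the vertex `1`. -/
def parent (m : ℕ) (c : ℕ × List ℕ) (j : ℕ) : ℕ :=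
  if j ≤ c.1 + 1 then j - 2 else if j = m + 3 then 1 else c.2.getD (j - (c.1 + 2)) 0

/-- The set of edges `{parent j, j}`, where `2 ≤ j`. -/
def codeBlocker (m : ℕ) (c : ℕ × List ℕ) : Finset (Sym2 (Fin (m + 4))) :=
  (Finset.univ.filter fun j : Fin (m + 4) => 2 ≤ (j : ℕ)).image
    fun j : Fin (m + 4) => s(Fin.ofNat (m + 4) (parent m c j), j)

theorem parent_of_le {m j : ℕ} {c : ℕ × List ℕ} (h : j ≤ c.1 + 1) : parent m c j = j - 2 :=
  if_pos h

theorem card_codeBlocker_le (m : ℕ) (c : ℕ × List ℕ) : (codeBlocker m c).card ≤ m + 2 := by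
  refine Finset.card_image_le.trans (le_of_eq ?_)
  have h : (Finset.univ.filter fun j : Fin (m + 4) => 2 ≤ (j : ℕ)) =
      Finset.Ici (⟨2, by omega⟩ : Fin (m + 4)) := by
    ext j; simp [Fin.le_def]
  rw [h, Fin.card_Ici]
  simp

section
variable {m : ℕ} {c : ℕ × List ℕ}

theorem parent_last (hc : c ∈ sizedWords m) : parent m c (m + 3) = 1 := by
  obtain ⟨h1, h2, -⟩ := mem_sizedWords.1 hc
  rw [parent, if_neg (by omega), if_pos rfl]

theorem parent_letter (hc : c ∈ sizedWords m) {q : ℕ} (hq : q < c.2.length) :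
    parent m c (c.1 + 2 + q) = c.2[q] := by
  obtain ⟨h1, h2, -⟩ := mem_sizedWords.1 hc
  rw [parent, if_neg (by omega), if_neg (by omega), Nat.add_sub_cancel_left,
    List.getD_eq_getElem _ _ hq]

theorem letter_le_succ (hc : c ∈ sizedWords m) {q q' : ℕ} (hqq : q < q') (hq : q' < c.2.length) :
    c.2[q'] ≤ c.2[q] + 1 :=
  List.pairwise_iff_getElem.1 (mem_sizedWords.1 hc).2.2.1 q q' (by omega) hq hqq

theorem first_letter_lt (hc : c ∈ sizedWords m) (hq : 0 < c.2.length) : c.2[0] < c.1 :=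
  (mem_sizedWords.1 hc).2.2.2 _ (by rw [List.head?_eq_getElem?, List.getElem?_eq_getElem hq]; rfl)

theorem letter_le (hc : c ∈ sizedWords m) {q : ℕ} (hq : q < c.2.length) : c.2[q] ≤ c.1 := by
  have h0 := first_letter_lt hc (by omega)
  rcases Nat.eq_zero_or_pos q with rfl | h
  · omega
  · have := letter_le_succ hc h hq; omega

/-- The three ranges of the vertices `2 ≤ j` in the blocker of a code. -/
theorem parent_cases (hc : c ∈ sizedWords m) {j : ℕ} (hj : 2 ≤ j) (hjm : j < m + 4) :
    (j ≤ c.1 + 1 ∧ parent m c j + 2 = j) ∨ (c.1 + 2 ≤ j ∧ j = m + 3 ∧ parent m c j = 1) ∨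
      ∃ (q : ℕ) (hq : q < c.2.length), j = c.1 + 2 + q ∧ parent m c j = c.2[q] := by
  obtain ⟨h1, h2, -⟩ := mem_sizedWords.1 hc
  rcases Nat.lt_or_ge (c.1 + 1) j with h3 | h3
  · right
    rcases Nat.eq_or_lt_of_le (show j ≤ m + 3 by omega) with rfl | h4
    · exact Or.inl ⟨h3, rfl, parent_last hc⟩
    · right
      obtain ⟨q, rfl⟩ : ∃ q, j = c.1 + 2 + q := ⟨j - (c.1 + 2), by omega⟩
      exact ⟨q, by omega, rfl, parent_letter hc (by omega)⟩
  · exact Or.inl ⟨h3, by rw [parent_of_le h3]; omega⟩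

theorem parent_add_two_le (hc : c ∈ sizedWords m) {j : ℕ} (hj : 2 ≤ j) (hjm : j < m + 4) :
    parent m c j + 2 ≤ j := by
  have h1 := (mem_sizedWords.1 hc).1
  rcases parent_cases hc hj hjm with h | h | ⟨q, hq, h⟩
  · omega
  · omega
  · have := letter_le hc hq; omega

theorem edgeRel_codeBlocker (hc : c ∈ sizedWords m) {i j : ℕ} (hij : i < j) (hj : j < m + 4) :
    edgeRel (codeBlocker m c) i j ↔ 2 ≤ j ∧ parent m c j = i := by
  simp only [edgeRel, codeBlocker, Finset.mem_image, Finset.mem_filter, Finset.mem_univ, true_and]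
  constructor
  · rintro ⟨hi, _, k, hk, h⟩
    have h1 := parent_add_two_le hc hk k.isLt
    have h2 : ((Fin.ofNat (m + 4) (parent m c k) : Fin (m + 4)) : ℕ) = parent m c k :=
      Nat.mod_eq_of_lt (by omega)
    rcases Sym2.eq_iff.1 h with ⟨h3, h4⟩ | ⟨h3, h4⟩
    · subst h4
      exact ⟨hk, by rw [← h2, h3]⟩
    · have h5 := congrArg Fin.val h3
      have h6 := congrArg Fin.val h4
      simp only at h5 h6
      omega
  · rintro ⟨h1, h2⟩
    refine ⟨by omega, hj, ⟨j, hj⟩, h1, Sym2.eq_iff.2 (Or.inl ⟨Fin.ext ?_, rfl⟩)⟩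
    simp only [h2]
    exact Nat.mod_eq_of_lt (by omega)

theorem rootedBy_codeBlocker (hc : c ∈ sizedWords m) :
    RootedBy (m + 4) (parent m c) (edgeRel (codeBlocker m c)) where
  symm := edgeRel_symm _
  edge_iff i j hij hj := edgeRel_codeBlocker hc hij hj
  le j hj hjm := parent_add_two_le hc hj hjm
  last := (parent_last hc).ge
  cross i j hi hij hj h1 h2 := by
    have h3 := parent_add_two_le hc hi (by omega)
    rcases parent_cases hc hi (by omega) with h | h | ⟨q, hq, h⟩
    · omega
    · omega
    rcases parent_cases hc (show 2 ≤ j by omega) hj with h' | h' | ⟨q', hq', h'⟩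
    · omega
    · omega
    · have := letter_le_succ hc (show q < q' by omega) hq'
      omega

variable {p : Fin (m + 4) → Plane}

theorem isBlockingSet_codeBlocker (hp : IsClockwiseConvexPolygon p) (hc : c ∈ sizedWords m) :
    IsBlockingSet p (codeBlocker m c) := by
  refine (isBlockingSet_iff hp (by omega)).2
    ⟨fun e he => ?_, (rootedBy_codeBlocker hc).blk (by omega)⟩
  obtain ⟨j, hj, rfl⟩ := Finset.mem_image.1 he
  have h1 := parent_add_two_le hc (Finset.mem_filter.1 hj).2 j.isLt
  rw [Sym2.mk_isDiag_iff]
  intro h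
  have h2 : parent m c j % (m + 4) = j := congrArg Fin.val h
  rw [Nat.mod_eq_of_lt (by omega)] at h2
  omega

theorem card_codeBlocker (hp : IsClockwiseConvexPolygon p) (hc : c ∈ sizedWords m) :
    (codeBlocker m c).card = m + 2 :=
  (card_codeBlocker_le m c).antisymm
    ((isBlockingSet_codeBlocker hp hc).le_card hp (by omega))

theorem isBlocker_codeBlocker (hp : IsClockwiseConvexPolygon p) (hc : c ∈ sizedWords m) :
    IsBlocker p (codeBlocker m c) :=
  ⟨isBlockingSet_codeBlocker hp hc, fun B' hB' => by
    rw [card_codeBlocker hp hc]; exact hB'.le_card hp (by omega)⟩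

theorem IsBlocker.card_eq (hp : IsClockwiseConvexPolygon p) {B : Finset (Sym2 (Fin (m + 4)))}
    (hB : IsBlocker p B) : B.card = m + 2 := by
  have hc : (m + 1, []) ∈ sizedWords m := mem_sizedWords.2 (by simp)
  refine le_antisymm ?_ (hB.1.le_card hp (by omega))
  rw [← card_codeBlocker hp hc]
  exact hB.2 _ (isBlockingSet_codeBlocker hp hc)

theorem IsBlocker.minBlk (hp : IsClockwiseConvexPolygon p) {B : Finset (Sym2 (Fin (m + 4)))}
    (hB : IsBlocker p B) : MinBlk (m + 4) (edgeRel B) :=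
  ⟨edgeRel_symm B, ((isBlockingSet_iff hp (by omega)).1 hB.1).2, by
    have h1 := degSum_edgeRel_le B
    have h2 := hB.card_eq hp
    omega⟩

end

/-! ### Every blocker is a rotation of one that comes from a word -/

/-- A rotation after which a smallest blocking set contains the ears at `0, …, s - 1`, and no other
ears unless the polygon is a quadrilateral. -/
theorem MinBlk.exists_normal_rotation {m : ℕ} {E : ℕ → ℕ → Prop} (h : MinBlk (m + 4) E) :
    ∃ r s, 2 ≤ s ∧ s ≤ m + 2 ∧ (∀ i, i < s → ear (m + 4) (_root_.rot (m + 4) r E) i) ∧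
      (1 ≤ m → ∀ i, s ≤ i → i < m + 4 → ¬ear (m + 4) (_root_.rot (m + 4) r E) i) := by
  cases m with
  | zero =>
    refine ⟨0, 2, le_rfl, le_rfl, fun i hi => ?_, fun h => by omega⟩
    by_contra hcon
    have h1 := h.rot 0
    rw [← ear_of_rot_last (by omega)] at hcon
    exact absurd ((h1.blk.rot (i + 1)).restrict (rot_symm h1.symm) hcon).four_le (by omega)
  | succ m =>
    obtain ⟨r, s, h1, h2, H⟩ := h.exists_ears_interval (by omega)
    refine ⟨r, s, h1, by omega, fun i hi => (H i (by omega)).2 hi, fun _ i hi hin => ?_⟩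
    rw [H i hin]; omega

/-- A smallest blocking set contains, after a rotation, the edges of the blocker of some code. -/
theorem MinBlk.exists_code {m : ℕ} {E : ℕ → ℕ → Prop} (h : MinBlk (m + 4) E) :
    ∃ r, ∃ c ∈ codes m, ∀ j, 2 ≤ j → j < m + 4 → _root_.rot (m + 4) r E (parent m c j) j := by
  obtain ⟨r, s, hs, hsm, hear, hno⟩ := h.exists_normal_rotation
  have hF := h.rot r
  set F := _root_.rot (m + 4) r E
  have hX : CrossAdj (m + 4) F := hF.crossAdj (by omega)
  -- the vertices whose ear is missing have exactly one neighbour, and it has an ear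
  have ex : ∀ j, ∃ w, s + 1 ≤ j → j < m + 3 → w < s ∧ F w j := by
    intro j
    by_cases hj : s + 1 ≤ j ∧ j < m + 3
    · obtain ⟨w, hw, -, -, -, hEw, hwear⟩ :=
        hF.exists_neighbor (v := j) (by omega) (hno (by omega) j (by omega) (by omega))
      refine ⟨w, fun _ _ => ⟨?_, hF.symm _ _ hEw⟩⟩
      by_contra hcon
      exact hno (by omega) w (by omega) hw hwear
    · exact ⟨0, fun h1 h2 => absurd ⟨h1, h2⟩ hj⟩
  choose f hf using ex
  have hfirst : s + 1 < m + 3 → f (s + 1) + 1 < s := by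
    intro h1
    obtain ⟨h2, h3⟩ := hf (s + 1) le_rfl h1
    by_contra hcon
    refine hno (by omega) s le_rfl (by omega) ((ear_mid (by omega) (by omega)).2 ?_)
    rwa [show s - 1 = f (s + 1) by omega]
  have hlast : s + 1 < m + 3 → f (m + 2) ≠ 0 := by
    intro h1 h0
    obtain ⟨h2, h3⟩ := hf (m + 2) (by omega) (by omega)
    refine hno (by omega) (m + 3) (by omega) (by omega) ((ear_last (by omega) (by omega)).2 ?_)
    rw [h0] at h3
    exact hF.symm _ _ h3
  have hpair : ∀ i j, s + 1 ≤ i → i < j → j < m + 3 → f j ≤ f i + 1 := by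
    intro i j hi hij hj
    obtain ⟨h1, h2⟩ := hf i hi (by omega)
    obtain ⟨h3, h4⟩ := hf j (by omega) hj
    by_contra hcon
    have hi' := hno (by omega) i (by omega) (by omega)
    rcases hX (f i) (f j) i j (by omega) (by omega) hij (by omega) h2 h4 with h | h | h | h
    · omega
    · exact hi' h.2.2
    · exact hi' h.2.1
    · omega
  let g : List ℕ := (List.range (m + 2 - s)).map fun q => f (s + 1 + q)
  have hlen : g.length = m + 2 - s := by simp [g]
  have hword : (s - 1, g) ∈ sizedWords m := by
    refine mem_sizedWords.2 ⟨by simp only; omega, by simp only [hlen]; omega, ?_, ?_⟩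
    · rw [List.pairwise_map]
      refine List.pairwise_lt_range.imp_of_mem fun {a b} _ hb hab => ?_
      have := List.mem_range.1 hb
      exact hpair _ _ (by omega) (by omega) (by omega)
    · intro x hx
      rcases Nat.eq_zero_or_pos (m + 2 - s) with h0 | h0
      · simp [g, h0] at hx
      · have hlt : 0 < g.length := by omega
        dsimp only at hx
        rw [List.head?_eq_getElem?, List.getElem?_eq_getElem hlt, Option.mem_some_iff] at hx
        subst hx
        have := hfirst (by omega)
        simp only [g, List.getElem_map, List.getElem_range, Nat.add_zero]
        omega
  refine ⟨r, (s - 1, g), Finset.mem_filter.2 ⟨hword, fun h0 => ?_⟩, fun j hj hjm => ?_⟩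
  · rcases Nat.eq_zero_or_pos (m + 2 - s) with h1 | h1
    · simp [g, h1] at h0
    · have hlt : g.length - 1 < g.length := by omega
      dsimp only at h0
      rw [List.getLast?_eq_getElem?, List.getElem?_eq_getElem hlt, Option.some_inj] at h0
      simp only [hlen, g, List.getElem_map, List.getElem_range] at h0
      rw [show s + 1 + (m + 2 - s - 1) = m + 2 by omega] at h0
      exact hlast (by omega) h0
  · rcases parent_cases hword hj hjm with h1 | h1 | ⟨q, hq, h1, h2⟩
    · dsimp only at h1
      have h2 := (ear_mid (by omega) (by omega)).1 (hear (j - 1) (by omega))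
      rwa [show j - 1 - 1 = parent m (s - 1, g) j by omega, show j - 1 + 1 = j by omega] at h2
    · rw [h1.2.2, h1.2.1]
      exact hF.symm _ _ ((ear_zero (by omega)).1 (hear 0 (by omega)))
    · dsimp only at hq h1 h2
      rw [h2]
      simp only [g, List.getElem_map, List.getElem_range]
      rw [show s + 1 + q = j by omega]
      exact (hf j (by omega) (by omega)).2

theorem finRotate_pow_val (n r : ℕ) (i : Fin (n + 1)) :
    (((finRotate (n + 1)) ^ r) i : ℕ) = (i + r) % (n + 1) := by
  induction r with
  | zero => simp [Nat.mod_eq_of_lt i.isLt]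
  | succ r ih =>
    rw [pow_succ', Equiv.Perm.mul_apply, finRotate_apply, Fin.val_add, ih, Fin.val_one',
      ← Nat.add_mod, add_assoc]

theorem mem_zpowers_finRotate {n : ℕ} {g : Equiv.Perm (Fin n)} :
    g ∈ Subgroup.zpowers (finRotate n) ↔ ∃ r : ℕ, finRotate n ^ r = g := by
  rw [← mem_powers_iff_mem_zpowers, Submonoid.mem_powers_iff]

theorem IsBlocker.exists_isRotationOf {m : ℕ} {p : Fin (m + 4) → Plane}
    (hp : IsClockwiseConvexPolygon p) {B : Finset (Sym2 (Fin (m + 4)))} (hB : IsBlocker p B) :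
    ∃ c ∈ codes m, IsRotationOf (codeBlocker m c) B := by
  obtain ⟨r, c, hc, H⟩ := (hB.minBlk hp).exists_code
  have hc' := (Finset.mem_filter.1 hc).1
  refine ⟨c, hc, finRotate (m + 4) ^ r, mem_zpowers_finRotate.2 ⟨r, rfl⟩, ?_⟩
  refine Finset.eq_of_subset_of_card_le (fun e he => ?_) ?_
  · obtain ⟨e', he', rfl⟩ := Finset.mem_image.1 he
    obtain ⟨j, hj, rfl⟩ := Finset.mem_image.1 he'
    have hj2 := (Finset.mem_filter.1 hj).2
    have h1 := parent_add_two_le hc' hj2 j.isLt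
    have h2 := H j hj2 j.isLt
    rw [Sym2.map_mk, ← edgeRel_fin, finRotate_pow_val, finRotate_pow_val]
    rw [rot] at h2
    have h3 : ((Fin.ofNat (m + 4) (parent m c j) : Fin (m + 4)) : ℕ) = parent m c j :=
      Nat.mod_eq_of_lt (by omega)
    rw [h3]
    exact h2
  · rw [Finset.card_image_of_injective _ (Sym2.map.injective (Equiv.injective _)),
      hB.card_eq hp, card_codeBlocker hp hc']

/-! ### Different words give blockers that are not rotations of each other -/

theorem ear_codeBlocker {m : ℕ} (hm : 1 ≤ m) {c : ℕ × List ℕ} (hc : c ∈ codes m) {i : ℕ}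
    (hi : i < m + 4) : ear (m + 4) (edgeRel (codeBlocker m c)) i ↔ i ≤ c.1 := by
  obtain ⟨hw, hlast⟩ := Finset.mem_filter.1 hc
  obtain ⟨h1, h2, -⟩ := mem_sizedWords.1 hw
  rcases Nat.eq_zero_or_pos i with rfl | hi0
  · rw [ear_zero (by omega)]
    exact ⟨fun _ => by omega, fun _ => edgeRel_symm _ _ _
      ((edgeRel_codeBlocker hw (by omega) (by omega)).2 ⟨by omega, parent_last hw⟩)⟩
  rcases Nat.lt_or_ge (i + 1) (m + 4) with h3 | h3
  · rw [ear_mid hi0 h3, edgeRel_codeBlocker hw (by omega) h3]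
    rcases parent_cases hw (show 2 ≤ i + 1 by omega) h3 with h | h | ⟨q, hq, h, h'⟩
    · omega
    · omega
    · have h4 := letter_le hw hq
      rcases Nat.eq_zero_or_pos q with rfl | hq0
      · have := first_letter_lt hw hq
        omega
      · omega
  · rw [ear_last (by omega) (by omega)]
    refine ⟨fun h => ?_, fun h => by omega⟩
    have h := ((edgeRel_codeBlocker hw (by omega) (by omega)).1 (edgeRel_symm _ _ _ h))
    rcases parent_cases hw h.1 (by omega) with h4 | h4 | ⟨q, hq, h4, h5⟩
    · omega
    · omega
    · refine absurd ?_ hlast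
      rw [List.getLast?_eq_getElem?, List.getElem?_eq_getElem (by omega), Option.some_inj,
        ← h.2, h5]
      congr 1
      omega

/-- The edges of the blocker of a code determine the code. -/
theorem code_ext {m : ℕ} {c c' : ℕ × List ℕ} (hc : c ∈ sizedWords m) (hc' : c' ∈ sizedWords m)
    (h1 : c.1 = c'.1) (h : ∀ i j, i < m + 4 → j < m + 4 →
      (edgeRel (codeBlocker m c) i j ↔ edgeRel (codeBlocker m c') i j)) : c = c' := by
  have a1 := (mem_sizedWords.1 hc).2.1
  have a2 := (mem_sizedWords.1 hc').2.1
  refine Prod.ext h1 (List.ext_getElem (by omega) fun q hq hq' => ?_)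
  rw [← parent_letter hc hq, ← parent_letter hc' hq', h1]
  have h2 := parent_add_two_le hc (j := c'.1 + 2 + q) (by omega) (by omega)
  have h3 := (h (parent m c (c'.1 + 2 + q)) (c'.1 + 2 + q) (by omega) (by omega)).1
    ((edgeRel_codeBlocker hc (by omega) (by omega)).2 ⟨by omega, rfl⟩)
  exact ((edgeRel_codeBlocker hc' (by omega) (by omega)).1 h3).2.symm

theorem edgeRel_image_rotate {n : ℕ} (B : Finset (Sym2 (Fin (n + 1)))) (r : ℕ) {i j : ℕ}
    (hi : i < n + 1) (hj : j < n + 1) :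
    rot (n + 1) r (edgeRel (B.image (Sym2.map (finRotate (n + 1) ^ r)))) i j ↔ edgeRel B i j := by
  have h1 := finRotate_pow_val n r ⟨i, hi⟩
  have h2 := finRotate_pow_val n r ⟨j, hj⟩
  dsimp only at h1 h2
  rw [rot, ← h1, ← h2, edgeRel_fin, ← Sym2.map_mk,
    (Sym2.map.injective (Equiv.injective _)).mem_finset_image]
  exact (edgeRel_fin (i := ⟨i, hi⟩) (j := ⟨j, hj⟩)).symm

theorem eq_of_isRotationOf {m : ℕ} {c c' : ℕ × List ℕ} (hc : c ∈ codes m) (hc' : c' ∈ codes m)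
    (h : IsRotationOf (codeBlocker m c) (codeBlocker m c')) : c = c' := by
  have hw := (Finset.mem_filter.1 hc).1
  have hw' := (Finset.mem_filter.1 hc').1
  obtain ⟨h1, h2, -⟩ := mem_sizedWords.1 hw
  obtain ⟨h1', h2', -⟩ := mem_sizedWords.1 hw'
  rcases Nat.eq_zero_or_pos m with rfl | hm
  · exact Prod.ext (by omega) (by
      rw [List.length_eq_zero_iff.1 (show c.2.length = 0 by omega),
        List.length_eq_zero_iff.1 (show c'.2.length = 0 by omega)])
  obtain ⟨_, hg, hr⟩ := h
  obtain ⟨r, rfl⟩ := mem_zpowers_finRotate.1 hg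
  have hrel : ∀ i j, i < m + 4 → j < m + 4 → (rot (m + 4) r (edgeRel (codeBlocker m c')) i j ↔
      edgeRel (codeBlocker m c) i j) := by
    intro i j hi hj
    rw [← hr]
    exact edgeRel_image_rotate _ r hi hj
  have hears : ∀ i, i < m + 4 → (i ≤ c.1 ↔ (i + r) % (m + 4) ≤ c'.1) := by
    intro i hi
    rw [← ear_codeBlocker hm hc hi, ← ear_codeBlocker hm hc' (Nat.mod_lt _ (by omega)), ← ear_rot]
    exact (ear_congr (by omega) hrel).symm
  -- the ears of both blockers begin at the vertex `0`, hence the rotation is trivial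
  have hr0 : r % (m + 4) = 0 := by
    have h3 := hears 0 (by omega)
    have h4 := hears (m + 3) (by omega)
    rw [Nat.add_mod, Nat.mod_eq_of_lt (show m + 3 < m + 4 by omega)] at h4
    rw [Nat.zero_add] at h3
    have h5 := Nat.mod_lt r (show 0 < m + 4 by omega)
    have h6 := mod_cases (n := m + 4) (x := m + 3 + r % (m + 4)) (by omega)
    omega
  have hmod : ∀ i, i < m + 4 → (i + r) % (m + 4) = i := by
    intro i hi
    rw [Nat.add_mod, hr0, Nat.add_zero, Nat.mod_mod, Nat.mod_eq_of_lt hi]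
  refine code_ext hw hw' ?_ fun i j hi hj => ?_
  · have h3 := hears c.1 (by omega)
    have h4 := hears c'.1 (by omega)
    rw [hmod _ (by omega)] at h3 h4
    omega
  · rw [← hrel i j hi hj, rot, hmod i hi, hmod j hj]

/-! ### The number of blockers -/

theorem theorem2 (n : ℕ) (hn : 4 ≤ n) (p : Fin n → Plane) (hp : IsClockwiseConvexPolygon p) :
    blockerCount p = fibF (2 * n - 8) := by
  obtain ⟨m, rfl⟩ : ∃ m, n = m + 4 := ⟨n - 4, by omega⟩
  rw [show 2 * (m + 4) - 8 = 2 * m by omega, ← card_codes, blockerCount]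
  let f : {c // c ∈ codes m} → Quotient (rotationSetoid p) := fun c =>
    Quotient.mk (rotationSetoid p)
      ⟨codeBlocker m c.1, isBlocker_codeBlocker hp (Finset.mem_filter.1 c.2).1⟩
  have hf : Function.Bijective f := by
    constructor
    · intro c c' h
      exact Subtype.ext (eq_of_isRotationOf c.2 c'.2 (Quotient.exact h))
    · intro q
      induction q using Quotient.inductionOn with
      | h B =>
        obtain ⟨c, hc, h⟩ := B.2.exists_isRotationOf hp
        exact ⟨⟨c, hc⟩, Quotient.sound h⟩
  rw [← Nat.card_eq_of_bijective f hf, Nat.card_eq_fintype_card, Fintype.card_coe]
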